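/- Let $P$ be a simple polygon in the plane, regarded as a closed region (boundary together with the enclosed bounded region). For points $x,y\in P$ let $d(x,y)$ be the geodesic distance inside $P$, i.e. the infimum of the Euclidean lengths of paths from $x$ to $y$ that stay in $P$. Let $A,B:[0,1]\to P$ be polygonal curves, with breakpoints $0=\sigma_0<\dots<\sigma_m=1$ and $0=\tau_0<\dots<\tau_n=1$, such that $A$ is affine on each $[\sigma_{i-1},\sigma_i]$ and $B$ is affine on each $[\tau_{j-1},\tau_j]$. For $\varepsilon\in\mathbb{R}$ let $$FS_\varepsilon(A,B)=\{(s,t)\in[0,1]^2 \mid d(A(s),B(t))\le\varepsilon\},$$ and let $C=[\sigma_{i-1},\sigma_i]\times[\tau_{j-1},\tau_j]$ be the free space cell defined by the $i$-th segment of $A$ and the $j$-th segment of $B$, where $1\le i\le m$ and $1\le j\le n$. A free space region of $C$ is a connected component of $FS_\varepsilon(A,B)\cap C$. A planar set is called $x$-monotone (resp. $y$-monotone) if its intersection with every vertical (resp. horizontal) line is connected (possibly empty). Then, for every $\varepsilon$, the cell $C$ contains at most one free space region. If there is such a region $R$, then $R$ is the whole free space $FS_\varepsilon(A,B)\cap C$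 in the cell, and $R$ is $x$-monotone, $y$-monotone and connected. -/

import Mathlib

open scoped ENNReal

noncomputable section

/-- The Euclidean plane, with the `L₂` norm. -/
abbrev Plane : Type := EuclideanSpace ℝ (Fin 2)

/-- A polygon is simple if its closed boundary curve has no self-intersection. The half-open
edges (each edge with its start point and without its end point) cover the boundary once around,
so the condition is that a boundary point lies on exactly one half-open edge, at exactly one
parameter. -/
def IsSimplePolygon {k : ℕ} (P : Polygon Plane k) : Prop :=
  3 ≤ k ∧ ∀ i j : Fin k, ∀ s ∈ Set.Ico (0 : ℝ) 1, ∀ t ∈ Set.Ico (0 : ℝ) 1,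
    P.edgePath ℝ i s = P.edgePath ℝ j t → i = j ∧ s = t

/-- The open region enclosed by the polygon: the points off the boundary whose connected
component in the complement of the boundary is bounded. -/
def polygonInterior {k : ℕ} (P : Polygon Plane k) : Set Plane :=
  {x | x ∈ (P.boundary ℝ)ᶜ ∧ Bornology.IsBounded (connectedComponentIn (P.boundary ℝ)ᶜ x)}

/-- The closed region bounded by the polygon (enclosed open region together with the boundary);
everything outside it is the obstacle. -/
def polygonRegion {k : ℕ} (P : Polygon Plane k) : Set Plane :=
  P.boundary ℝ ∪ polygonInterior P

/-- The geodesic distance inside the polygon: the infimum of the Euclidean lengths of the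
continuous paths from `x` to `y` that stay in the closed polygonal region (`∞` if there is no
rectifiable path of this kind). -/
def geodesicDist {k : ℕ} (P : Polygon Plane k) (x y : Plane) : ℝ≥0∞ :=
  ⨅ (γ : Path x y) (_ : ∀ t, γ t ∈ polygonRegion P), eVariationOn γ Set.univ

/-- A polygonal curve `[0,1] → ℝ²` with `m` segments: there are breakpoints
`0 = τ₀ < τ₁ < ⋯ < τₘ = 1`, and between consecutive breakpoints the curve runs affinely along the
segment that joins its values there. Values outside `[0,1]` play no role. -/
structure PolygonalCurve (m : ℕ) where
  toFun : ℝ → Plane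
  breakpoint : Fin (m + 1) → ℝ
  strictMono : StrictMono breakpoint
  breakpoint_zero : breakpoint 0 = 0
  breakpoint_last : breakpoint (Fin.last m) = 1
  affine : ∀ i : Fin m, ∀ s ∈ Set.Icc (breakpoint i.castSucc) (breakpoint i.succ),
    toFun s = AffineMap.lineMap (toFun (breakpoint i.castSucc)) (toFun (breakpoint i.succ))
      ((s - breakpoint i.castSucc) / (breakpoint i.succ - breakpoint i.castSucc))

/-- The curve lies inside the polygon (touching the boundary is allowed). -/
def PolygonalCurve.LiesIn {m k : ℕ} (A : PolygonalCurve m) (P : Polygon Plane k) : Prop :=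
  ∀ s ∈ Set.Icc (0 : ℝ) 1, A.toFun s ∈ polygonRegion P

/-- The parameter interval of the `i`-th segment of a polygonal curve. -/
def PolygonalCurve.segmentInterval {m : ℕ} (A : PolygonalCurve m) (i : Fin m) : Set ℝ :=
  Set.Icc (A.breakpoint i.castSucc) (A.breakpoint i.succ)

/-- The geodesic free space `{(s,t) ∈ [0,1]² | d(A(s), B(t)) ≤ ε}`. -/
def freeSpace {k m n : ℕ} (P : Polygon Plane k) (A : PolygonalCurve m) (B : PolygonalCurve n)
    (ε : ℝ) : Set (ℝ × ℝ) :=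
  {p | p.1 ∈ Set.Icc (0 : ℝ) 1 ∧ p.2 ∈ Set.Icc (0 : ℝ) 1 ∧
    ((geodesicDist P (A.toFun p.1) (B.toFun p.2) : ℝ≥0∞) : EReal) ≤ (ε : EReal)}

/-- The free space cell of the `i`-th segment of `A` and the `j`-th segment of `B`. -/
def freeSpaceCell {m n : ℕ} (A : PolygonalCurve m) (B : PolygonalCurve n)
    (i : Fin m) (j : Fin n) : Set (ℝ × ℝ) :=
  A.segmentInterval i ×ˢ B.segmentInterval j

/-- The regions of a set are its connected components. -/
def regions (S : Set (ℝ × ℝ)) : Set (Set (ℝ × ℝ)) :=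
  {R | ∃ p ∈ S, R = connectedComponentIn S p}

/-- A planar set is `x`-monotone if it meets every vertical line in a connected (possibly empty)
set. -/
def IsXMonotone (R : Set (ℝ × ℝ)) : Prop :=
  ∀ x : ℝ, IsPreconnected (R ∩ {p | p.1 = x})

/-- A planar set is `y`-monotone if it meets every horizontal line in a connected (possibly empty)
set. -/
def IsYMonotone (R : Set (ℝ × ℝ)) : Prop :=
  ∀ y : ℝ, IsPreconnected (R ∩ {p | p.2 = y})

end

/-!
The free space in a cell is convex; everything else follows from this. It is a sublevel set of
`(s, t) ↦ d(A(s), B(t))`, and both curves are affine on the cell, so it is enough that the inner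
distance of the polygonal region is quasiconvex along two segments in the region that are run
through at constant speed (`IsFilledRegion.innerDist_lineMap_le_max`). As this function is
continuous, a maximum principle (`le_max_of_eventually_midpoint_le`) reduces this to midpoint
convexity near every pair of points `x`, `y`, with a neighbourhood depending on the pair
(`IsFilledRegion.innerDist_midpoint_le`).

Local midpoint convexity comes from gates. Suppose that convex sets `E₁, …, Eₗ` have to be passed
one after the other on every path from a point near `x` to a point near `y`, and that each of `x`,
`E₁, …, Eₗ`, `y` sees the next one completely. The minimum of
`|x' - q₁| + |q₁ - q₂| + ⋯ + |qₗ - y'|` over `qᵢ ∈ Eᵢ` is a partial minimum of a convex function,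
hence jointly convex in `x'` and `y'` (`gateDist_midpoint_le`). It is a lower bound for the inner
distance near the pair `x`, `y` and agrees with it there.

The gates are found in the vertical decomposition of the region. Vertical lines through the
vertices, and through the crossings of the lines spanned by the edges, cut the region into convex
cells (`IsFilledRegion.exists_isCell`) and, on the vertical lines themselves, into maximal
segments, called doors. Along a shortest chain of alternately doors and closed cells from `x`
to `y`, the intersections of consecutive pieces are the gates (`IsFilledRegion.exists_gates`). That
they cannot be bypassed holds because the region has no holes: a cell separates its left side
from its right side within the region (`IsFilledRegion.exists_separation`). This is where
topology enters, and it needs no Jordan curve theorem. By definition of the region each outer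
point is connected to infinity outside it, and therefore `w - z` has a continuous logarithm on
the region for each outer point `z` (`IsFilledRegion.hasLogOn`). Apply this to two outer points
just above and below a cell: the continuous branch of the angle under which they are seen and the
principal branch, which jumps across the cell, differ by different multiples of `2π` on the two
sides.
-/

/-! ### The inner distance of a planar set -/

/-- The inner distance of a set `S`: the infimum of the lengths of the paths in `S` from `x`
to `y`. -/
noncomputable def innerDist (S : Set Plane) (x y : Plane) : ℝ≥0∞ :=
  ⨅ (γ : Path x y) (_ : ∀ t, γ t ∈ S), eVariationOn γ Set.univ

theorem innerDist_le_eVariationOn {S : Set Plane} {x y : Plane} (γ : Path x y)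
    (hγ : ∀ t, γ t ∈ S) : innerDist S x y ≤ eVariationOn γ Set.univ :=
  iInf₂_le γ hγ

theorem eVariationOn_extend_le {x y : Plane} (γ : Path x y) :
    eVariationOn γ.extend (Set.Icc 0 1) ≤ eVariationOn γ Set.univ := by
  have : (γ.extend : ℝ → Plane) = γ ∘ Set.projIcc (0 : ℝ) 1 zero_le_one := by
    ext t; rfl
  rw [this]
  exact eVariationOn.comp_le_of_monotoneOn _ _ ((Set.monotone_projIcc _).monotoneOn _)
    (fun _ _ => Set.mem_univ _)

theorem eVariationOn_trans_le {x y z : Plane} (γ : Path x y) (γ' : Path y z) :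
    eVariationOn (γ.trans γ') Set.univ ≤ eVariationOn γ Set.univ + eVariationOn γ' Set.univ := by
  let h : unitInterval := ⟨1 / 2, by constructor <;> norm_num⟩
  have huniv : (Set.univ : Set unitInterval) = Set.Iic h ∪ Set.Ici h := by
    simp
  have hsplit : eVariationOn (γ.trans γ') Set.univ = eVariationOn (γ.trans γ') (Set.Iic h) +
      eVariationOn (γ.trans γ') (Set.Ici h) := by
    rw [huniv, eVariationOn.union _ isGreatest_Iic isLeast_Ici]
  rw [hsplit]
  gcongr
  · have : Set.EqOn (γ.trans γ') (γ ∘ fun t : unitInterval => Set.projIcc (0 : ℝ) 1 zero_le_one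
        (2 * (t : ℝ))) (Set.Iic h) := by
      intro t ht
      have ht' : (t : ℝ) ≤ 1 / 2 := ht
      rw [Path.trans_apply, dif_pos ht', Function.comp_apply, Set.projIcc_of_mem]
    rw [eVariationOn.congr this]
    refine eVariationOn.comp_le_of_monotoneOn _ _ ?_ (fun _ _ => Set.mem_univ _)
    intro a _ b _ hab
    have : (a : ℝ) ≤ b := hab
    exact Set.monotone_projIcc _ (by linarith)
  · have : Set.EqOn (γ.trans γ') (γ' ∘ fun t : unitInterval => Set.projIcc (0 : ℝ) 1 zero_le_one
        (2 * (t : ℝ) - 1)) (Set.Ici h) := by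
      intro t ht
      have ht' : 1 / 2 ≤ (t : ℝ) := ht
      rcases eq_or_lt_of_le ht' with h1 | h1
      · have : t = h := Subtype.ext h1.symm
        subst this
        simp [Path.trans_apply, h]
      · rw [Path.trans_apply, dif_neg (not_le.2 h1), Function.comp_apply, Set.projIcc_of_mem]
    rw [eVariationOn.congr this]
    refine eVariationOn.comp_le_of_monotoneOn _ _ ?_ (fun _ _ => Set.mem_univ _)
    intro a _ b _ hab
    have : (a : ℝ) ≤ b := hab
    exact Set.monotone_projIcc _ (by linarith)

theorem innerDist_triangle (S : Set Plane) (x y z : Plane) :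
    innerDist S x z ≤ innerDist S x y + innerDist S y z := by
  suffices key : ∀ γ : Path x y, (∀ t, γ t ∈ S) → ∀ γ' : Path y z, (∀ t, γ' t ∈ S) →
      innerDist S x z ≤ eVariationOn γ Set.univ + eVariationOn γ' Set.univ by
    rw [innerDist.eq_1 S x y, innerDist.eq_1 S y z]
    simp only [ENNReal.iInf_add, ENNReal.add_iInf]
    exact le_iInf₂ fun γ' hγ' => le_iInf₂ fun γ hγ => key γ hγ γ' hγ'
  intro γ hγ γ' hγ'
  refine (innerDist_le_eVariationOn (γ.trans γ') ?_).trans (eVariationOn_trans_le γ γ')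
  intro t
  rw [Path.trans_apply]
  split_ifs
  · exact hγ _
  · exact hγ' _

theorem innerDist_le_edist {S : Set Plane} {x y : Plane} (h : segment ℝ x y ⊆ S) :
    innerDist S x y ≤ edist x y := by
  let γ : Path x y :=
    { toFun := fun t => AffineMap.lineMap x y (t : ℝ)
      continuous_toFun := by
        simp only [AffineMap.lineMap_apply]
        fun_prop
      source' := by simp
      target' := by simp }
  refine (innerDist_le_eVariationOn γ ?_).trans ?_
  · intro t
    apply h
    rw [← affineSegment_eq_segment]
    exact ⟨t, t.2, rfl⟩
  · have hL : LipschitzOnWith (nndist x y) (fun t : ℝ => AffineMap.lineMap x y t) Set.univ :=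
      (lipschitzWith_lineMap x y).lipschitzOnWith
    have := hL.comp_eVariationOn_le (g := fun t : unitInterval => (t : ℝ)) (s := Set.univ)
      (fun _ _ => Set.mem_univ _)
    have h2 : eVariationOn (fun t : unitInterval => (t : ℝ)) Set.univ ≤ 1 := by
      have hm : MonotoneOn (fun t : unitInterval => (t : ℝ)) Set.univ := fun a _ b _ hab => hab
      have := hm.eVariationOn_eq (a := 0) (b := 1) (Set.mem_univ _) (Set.mem_univ _)
      have hI : (Set.univ : Set unitInterval) ∩ Set.Icc 0 1 = Set.univ := by
        ext t; simp [unitInterval.le_one']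
      rw [hI] at this
      simpa using this.le
    calc eVariationOn γ Set.univ ≤ _ := this
      _ ≤ nndist x y * 1 := by gcongr
      _ = edist x y := by rw [mul_one, edist_nndist]

/-! ### Chains of gates -/

/-- The length of the shortest polygonal path from `x` to `y` with one vertex on each set of
a list, taken in order. -/
noncomputable def gateDist : List (Set Plane) → Plane → Plane → ℝ≥0∞
  | [], x, y => edist x y
  | E :: Es, x, y => ⨅ q ∈ E, edist x q + gateDist Es q y

theorem edist_midpoint_midpoint_le (a a' b b' : Plane) :
    2 * edist (midpoint ℝ a a') (midpoint ℝ b b') ≤ edist a b + edist a' b' := by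
  have h := dist_midpoint_midpoint_le a a' b b'
  have h2 : 2 * dist (midpoint ℝ a a') (midpoint ℝ b b') ≤ dist a b + dist a' b' := by
    linarith
  rw [edist_dist, edist_dist, edist_dist, ← ENNReal.ofReal_add dist_nonneg dist_nonneg]
  calc 2 * ENNReal.ofReal (dist (midpoint ℝ a a') (midpoint ℝ b b'))
      = ENNReal.ofReal (2 * dist (midpoint ℝ a a') (midpoint ℝ b b')) := by
        rw [ENNReal.ofReal_mul (by norm_num)]; simp
    _ ≤ _ := ENNReal.ofReal_le_ofReal h2

/-- Minimising the jointly convex function `|x - q₁| + |q₁ - q₂| + ⋯ + |qₗ - y|` over `qᵢ` in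
convex sets leaves a function that is jointly convex in `x` and `y`. -/
theorem gateDist_midpoint_le : ∀ {Es : List (Set Plane)}, (∀ E ∈ Es, Convex ℝ E) →
    ∀ x x' y y' : Plane, 2 * gateDist Es (midpoint ℝ x x') (midpoint ℝ y y') ≤
      gateDist Es x y + gateDist Es x' y'
  | [], _, x, x', y, y' => edist_midpoint_midpoint_le x x' y y'
  | E :: Es, h, x, x', y, y' => by
    simp only [gateDist, ENNReal.iInf_add, ENNReal.add_iInf]
    refine le_iInf₂ fun q' hq' => le_iInf₂ fun q hq => ?_
    have hm : midpoint ℝ q q' ∈ E :=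
      (h E (by simp)).segment_subset hq hq' (midpoint_mem_segment q q')
    calc 2 * ⨅ q ∈ E, edist (midpoint ℝ x x') q + gateDist Es q (midpoint ℝ y y')
        ≤ 2 * (edist (midpoint ℝ x x') (midpoint ℝ q q') +
            gateDist Es (midpoint ℝ q q') (midpoint ℝ y y')) := by
          gcongr; exact iInf₂_le _ hm
      _ = 2 * edist (midpoint ℝ x x') (midpoint ℝ q q') +
            2 * gateDist Es (midpoint ℝ q q') (midpoint ℝ y y') := mul_add _ _ _
      _ ≤ (edist x q + edist x' q') + (gateDist Es q y + gateDist Es q' y') := by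
          gcongr
          · exact edist_midpoint_midpoint_le _ _ _ _
          · exact gateDist_midpoint_le (fun E' hE' => h E' (by simp [hE'])) _ _ _ _
      _ = _ := add_add_add_comm _ _ _ _

/-- `E` is a gate of `P` between `S` and `Y`: a path in `P` from `S` to `Y` has to meet `E`, since
`P` is covered by two closed sets that contain `S` and `Y` and overlap only in `E`. -/
def IsGate (P S E Y : Set Plane) : Prop :=
  ∃ F G : Set Plane, IsClosed F ∧ IsClosed G ∧ P ⊆ F ∪ G ∧ P ∩ (F ∩ G) ⊆ E ∧ S ⊆ F ∧ Y ⊆ G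

/-- The sets of the list are gates that have to be passed one after the other on the way
from `S` to `Y`. -/
def Gated (P Y : Set Plane) : Set Plane → List (Set Plane) → Prop
  | _, [] => True
  | S, E :: Es => IsGate P S E Y ∧ Gated P Y E Es

/-- Every point of a set of the sequence `S, E₁, …, Eₗ, {y}` sees within `P` every point of the
next set. -/
def Visible (P : Set Plane) (y : Plane) : Set Plane → List (Set Plane) → Prop
  | S, [] => ∀ x ∈ S, segment ℝ x y ⊆ P
  | S, E :: Es => (∀ x ∈ S, ∀ q ∈ E, segment ℝ x q ⊆ P) ∧ Visible P y E Es

theorem Gated.anti {P Y S S' : Set Plane} {Es : List (Set Plane)} (h : Gated P Y S Es)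
    (hS : S' ⊆ S) : Gated P Y S' Es := by
  cases Es with
  | nil => trivial
  | cons E Es =>
    obtain ⟨⟨F, G, hF, hG, hc, hi, hs, hy⟩, h2⟩ := h
    exact ⟨⟨F, G, hF, hG, hc, hi, hS.trans hs, hy⟩, h2⟩

theorem Visible.anti {P S S' : Set Plane} {y : Plane} {Es : List (Set Plane)}
    (h : Visible P y S Es) (hS : S' ⊆ S) : Visible P y S' Es := by
  cases Es with
  | nil => exact fun x hx => h x (hS hx)
  | cons E Es => exact ⟨fun x hx => h.1 x (hS hx), h.2⟩

theorem IsGate.anti_right {P S E Y Y' : Set Plane} (h : IsGate P S E Y) (hY : Y' ⊆ Y) :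
    IsGate P S E Y' := by
  obtain ⟨F, G, hF, hG, hc, hi, hs, hy⟩ := h
  exact ⟨F, G, hF, hG, hc, hi, hs, hY.trans hy⟩

theorem Gated.anti_right {P Y Y' S : Set Plane} {Es : List (Set Plane)} (h : Gated P Y S Es)
    (hY : Y' ⊆ Y) : Gated P Y' S Es := by
  induction Es generalizing S with
  | nil => trivial
  | cons E Es ih => exact ⟨h.1.anti_right hY, ih h.2⟩

theorem Visible.innerDist_le {P S : Set Plane} {y : Plane} {Es : List (Set Plane)}
    (h : Visible P y S Es) {x : Plane} (hx : x ∈ S) : innerDist P x y ≤ gateDist Es x y := by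
  induction Es generalizing S x with
  | nil => exact innerDist_le_edist (h x hx)
  | cons E Es ih =>
    refine le_iInf₂ fun q hq => (innerDist_triangle P x q y).trans ?_
    gcongr
    · exact innerDist_le_edist (h.1 x hx q hq)
    · exact ih h.2 hq

theorem Gated.gateDist_le_eVariationOn {P Y S : Set Plane} {Es : List (Set Plane)}
    (h : Gated P Y S Es) {f : ℝ → Plane} {a b : ℝ} (hab : a ≤ b)
    (hf : ContinuousOn f (Set.Icc a b)) (hP : ∀ t ∈ Set.Icc a b, f t ∈ P) (ha : f a ∈ S)
    (hb : f b ∈ Y) : gateDist Es (f a) (f b) ≤ eVariationOn f (Set.Icc a b) := by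
  induction Es generalizing S a with
  | nil => exact eVariationOn.edist_le f (Set.left_mem_Icc.2 hab) (Set.right_mem_Icc.2 hab)
  | cons E Es ih =>
    obtain ⟨⟨F, G, hF, hG, hc, hi, hs, hy⟩, h2⟩ := h
    have himg : IsPreconnected (f '' Set.Icc a b) := isPreconnected_Icc.image f hf
    have hsub : f '' Set.Icc a b ⊆ P := by
      rintro _ ⟨t, ht, rfl⟩; exact hP t ht
    obtain ⟨_, ⟨t, ht, rfl⟩, hq⟩ := isPreconnected_closed_iff.1 himg F G hF hG (hsub.trans hc)
      ⟨f a, ⟨a, Set.left_mem_Icc.2 hab, rfl⟩, hs ha⟩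
      ⟨f b, ⟨b, Set.right_mem_Icc.2 hab, rfl⟩, hy hb⟩
    have htE : f t ∈ E := hi ⟨hP t ht, hq⟩
    have hsub' : Set.Icc t b ⊆ Set.Icc a b := Set.Icc_subset_Icc_left ht.1
    have h3 := ih h2 ht.2 (hf.mono hsub') (fun s hs => hP s (hsub' hs)) htE
    calc gateDist (E :: Es) (f a) (f b) ≤ edist (f a) (f t) + gateDist Es (f t) (f b) :=
          iInf₂_le _ htE
      _ ≤ eVariationOn f (Set.Icc a t) + eVariationOn f (Set.Icc t b) := by
          gcongr
          exact eVariationOn.edist_le f (Set.left_mem_Icc.2 ht.1) (Set.right_mem_Icc.2 ht.1)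
      _ = eVariationOn f (Set.Icc a b) := by
          have := eVariationOn.Icc_add_Icc f (s := Set.univ) ht.1 ht.2 (Set.mem_univ _)
          simpa using this

theorem Gated.gateDist_le_innerDist {P Y S : Set Plane} {Es : List (Set Plane)}
    (h : Gated P Y S Es) {x y : Plane} (hx : x ∈ S) (hy : y ∈ Y) :
    gateDist Es x y ≤ innerDist P x y := by
  refine le_iInf₂ fun γ hγ => le_trans ?_ (eVariationOn_extend_le γ)
  have := h.gateDist_le_eVariationOn (f := γ.extend) zero_le_one
    γ.continuous_extend.continuousOn (fun t ht => by
      rw [Path.extend_apply _ ht]; exact hγ _) (by simpa using hx) (by simpa using hy)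
  simpa using this

/-! ### Filled regions -/

/-- A filled region: a compact planar set without holes whose frontier is covered by the finitely
many segments `[u i, v i]`, themselves part of the region. The role of the frontier is expressed
by `subset_of_isPreconnected`: a connected set that avoids all the segments lies either inside or
outside. That there are no holes means that every outer point can be joined to infinity. -/
structure IsFilledRegion {ι : Type*} (u v : ι → Plane) (P : Set Plane) : Prop where
  isClosed : IsClosed P
  isBounded : Bornology.IsBounded P
  segment_subset : ∀ i, segment ℝ (u i) (v i) ⊆ P
  subset_of_isPreconnected : ∀ X : Set Plane, IsPreconnected X →
    (∀ i, Disjoint X (segment ℝ (u i) (v i))) → (X ∩ P).Nonempty → X ⊆ P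
  exists_unbounded : ∀ z ∉ P, ∃ X : Set Plane, IsPreconnected X ∧ z ∈ X ∧ Disjoint X P ∧
    ¬ Bornology.IsBounded X

theorem polygon_boundary_eq {k : ℕ} (P : Polygon Plane k) :
    P.boundary ℝ = ⋃ i, segment ℝ (P i) (P (finRotate k i)) := by
  simp only [Polygon.boundary, Polygon.edgeSet, affineSegment_eq_segment]

theorem isCompact_polygon_boundary {k : ℕ} (P : Polygon Plane k) :
    IsCompact (P.boundary ℝ) :=
  isCompact_iUnion fun i => by
    rw [Polygon.edgeSet_eq_image_edgePath]
    exact isCompact_Icc.image (AffineMap.continuous_of_finiteDimensional _)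

theorem connectedComponentIn_subset_polygonInterior {k : ℕ} {P : Polygon Plane k} {x : Plane}
    (hx : x ∈ polygonInterior P) :
    connectedComponentIn (P.boundary ℝ)ᶜ x ⊆ polygonInterior P := fun y hy =>
  ⟨connectedComponentIn_subset _ _ hy, by rw [← connectedComponentIn_eq hy]; exact hx.2⟩

theorem disjoint_connectedComponentIn_polygonRegion {k : ℕ} {P : Polygon Plane k} {z : Plane}
    (hz : z ∉ polygonRegion P) :
    Disjoint (connectedComponentIn (P.boundary ℝ)ᶜ z) (polygonRegion P) := by
  rw [Set.disjoint_left]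
  rintro y hy (hyb | hyi)
  · exact connectedComponentIn_subset _ _ hy hyb
  · refine hz (Or.inr ⟨fun h => hz (Or.inl h), ?_⟩)
    rw [connectedComponentIn_eq hy]
    exact hyi.2

theorem not_isBounded_connectedComponentIn {k : ℕ} {P : Polygon Plane k} {z : Plane}
    (hz : z ∉ polygonRegion P) :
    ¬ Bornology.IsBounded (connectedComponentIn (P.boundary ℝ)ᶜ z) := fun h =>
  hz (Or.inr ⟨fun h' => hz (Or.inl h'), h⟩)

theorem isClosed_polygonRegion {k : ℕ} (P : Polygon Plane k) : IsClosed (polygonRegion P) := by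
  rw [← isOpen_compl_iff, isOpen_iff_mem_nhds]
  intro z hz
  have hzb : z ∈ (P.boundary ℝ)ᶜ := fun h => hz (Or.inl h)
  have ho : IsOpen (connectedComponentIn (P.boundary ℝ)ᶜ z) :=
    (isCompact_polygon_boundary P).isClosed.isOpen_compl.connectedComponentIn
  refine Filter.mem_of_superset (ho.mem_nhds (mem_connectedComponentIn hzb)) ?_
  exact (disjoint_connectedComponentIn_polygonRegion hz).subset_compl_right

theorem isBounded_polygonRegion {k : ℕ} (P : Polygon Plane k) :
    Bornology.IsBounded (polygonRegion P) := by
  obtain ⟨R, hR0, hR⟩ := (isCompact_polygon_boundary P).isBounded.exists_pos_norm_le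
  refine (Metric.isBounded_closedBall (x := (0 : Plane)) (r := R)).subset ?_
  intro x hx
  by_contra hxR
  have hxR : R < ‖x‖ := by simpa using hxR
  rcases hx with hx | hx
  · exact absurd (hR x hx) (not_le.2 hxR)
  -- The ray from `x` away from the origin escapes to infinity off the boundary.
  have hray : IsPreconnected ((fun t : ℝ => t • x) '' Set.Ici 1) :=
    isPreconnected_Ici.image _ (by fun_prop)
  have hsub : (fun t : ℝ => t • x) '' Set.Ici 1 ⊆ (P.boundary ℝ)ᶜ := by
    rintro _ ⟨t, ht, rfl⟩ hb
    have h1 := hR _ hb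
    have ht : (1 : ℝ) ≤ t := ht
    simp only [norm_smul, Real.norm_eq_abs, abs_of_pos (zero_lt_one.trans_le ht)] at h1
    nlinarith [norm_nonneg x]
  have hcomp := hray.subset_connectedComponentIn ⟨1, Set.self_mem_Ici, one_smul ℝ x⟩ hsub
  obtain ⟨B, hB⟩ := (hx.2.subset hcomp).exists_norm_le
  have hx0 : 0 < ‖x‖ := hR0.trans hxR
  have h1 : (1 : ℝ) ≤ |B| / ‖x‖ + 1 := by
    have : 0 ≤ |B| / ‖x‖ := by positivity
    linarith
  have h2 := hB _ ⟨|B| / ‖x‖ + 1, h1, rfl⟩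
  simp only [norm_smul, Real.norm_eq_abs, abs_of_pos (zero_lt_one.trans_le h1)] at h2
  rw [add_mul, div_mul_cancel₀ _ hx0.ne'] at h2
  linarith [le_abs_self B]

theorem isFilledRegion_polygonRegion {k : ℕ} (P : Polygon Plane k) :
    IsFilledRegion (fun i => P i) (fun i => P (finRotate k i)) (polygonRegion P) where
  isClosed := isClosed_polygonRegion P
  isBounded := isBounded_polygonRegion P
  segment_subset i := by
    refine Set.Subset.trans ?_ Set.subset_union_left
    rw [polygon_boundary_eq]
    exact Set.subset_iUnion (fun i => segment ℝ (P i) (P (finRotate k i))) i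
  subset_of_isPreconnected X hX hd := by
    rintro ⟨y, hyX, hyP⟩
    have hb : X ⊆ (P.boundary ℝ)ᶜ := by
      intro w hw hwb
      rw [polygon_boundary_eq] at hwb
      obtain ⟨i, hi⟩ := Set.mem_iUnion.1 hwb
      exact Set.disjoint_left.1 (hd i) hw hi
    have hyi : y ∈ polygonInterior P := hyP.resolve_left (hb hyX)
    exact (hX.subset_connectedComponentIn hyX hb).trans
      ((connectedComponentIn_subset_polygonInterior hyi).trans Set.subset_union_right)
  exists_unbounded z hz :=
    ⟨_, isPreconnected_connectedComponentIn,
      mem_connectedComponentIn (show z ∈ (P.boundary ℝ)ᶜ from fun h => hz (Or.inl h)),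
      disjoint_connectedComponentIn_polygonRegion hz, not_isBounded_connectedComponentIn hz⟩

/-! ### Continuous logarithms on a filled region -/

/-- The plane as the complex line. -/
noncomputable def toComplex (p : Plane) : ℂ := ⟨p 0, p 1⟩

@[simp] theorem toComplex_re (p : Plane) : (toComplex p).re = p 0 := rfl

@[simp] theorem toComplex_im (p : Plane) : (toComplex p).im = p 1 := rfl

theorem norm_toComplex_sub (p q : Plane) : ‖toComplex p - toComplex q‖ = dist p q := by
  rw [EuclideanSpace.dist_eq, Fin.sum_univ_two, Complex.norm_eq_sqrt_sq_add_sq, Real.dist_eq,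
    Real.dist_eq, sq_abs, sq_abs]
  simp

theorem continuous_toComplex : Continuous toComplex := by
  refine Isometry.continuous (Isometry.of_dist_eq fun p q => ?_)
  rw [Complex.dist_eq, norm_toComplex_sub]

/-- The function `w ↦ w - z` has a continuous logarithm on `P`. -/
def HasLogOn (P : Set Plane) (z : Plane) : Prop :=
  ∃ L : Plane → ℂ, ContinuousOn L P ∧
    ∀ w ∈ P, Complex.exp (L w) = toComplex w - toComplex z

/-- The quotient `(w - z') / (w - z)` stays within distance `1` of `1`, so that the principal
logarithm of it is continuous. -/
theorem HasLogOn.of_dist_lt {P : Set Plane} {z z' : Plane} (h : HasLogOn P z)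
    (hd : ∀ w ∈ P, dist z' z < dist w z) : HasLogOn P z' := by
  obtain ⟨L, hL, hexp⟩ := h
  have hne : ∀ w ∈ P, toComplex w - toComplex z ≠ 0 := fun w hw => by
    rw [← hexp w hw]; exact Complex.exp_ne_zero _
  have hslit : ∀ w ∈ P, 1 + -((toComplex z' - toComplex z) / (toComplex w - toComplex z)) ∈
      Complex.slitPlane := by
    intro w hw
    apply Complex.mem_slitPlane_of_norm_lt_one
    have hpos : 0 < dist w z := dist_nonneg.trans_lt (hd w hw)
    rw [norm_neg, norm_div, norm_toComplex_sub, norm_toComplex_sub, div_lt_one hpos]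
    exact hd w hw
  refine ⟨fun w => L w +
    Complex.log (1 + -((toComplex z' - toComplex z) / (toComplex w - toComplex z))), ?_, ?_⟩
  · refine hL.add (ContinuousOn.clog ?_ hslit)
    refine continuousOn_const.add (ContinuousOn.neg (continuousOn_const.div ?_ hne))
    exact (continuous_toComplex.sub continuous_const).continuousOn
  · intro w hw
    rw [Complex.exp_add, hexp w hw, Complex.exp_log (Complex.slitPlane_ne_zero (hslit w hw))]
    field_simp [hne w hw]
    ring

theorem hasLogOn_of_norm_lt {P : Set Plane} {z : Plane} (h : ∀ w ∈ P, ‖w‖ < ‖z‖) :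
    HasLogOn P z := by
  rcases P.eq_empty_or_nonempty with rfl | ⟨w₀, hw₀⟩
  · exact ⟨fun _ => 0, continuousOn_const, by simp⟩
  have hn : ∀ p : Plane, ‖toComplex p‖ = ‖p‖ := fun p => by
    have := norm_toComplex_sub p 0
    have h0 : toComplex 0 = 0 := by apply Complex.ext <;> simp
    rwa [h0, sub_zero, dist_zero_right] at this
  have hz : 0 < ‖toComplex z‖ := by
    rw [hn]; exact (norm_nonneg _).trans_lt (h w₀ hw₀)
  have hz0 : toComplex z ≠ 0 := norm_pos_iff.1 hz
  have hslit : ∀ w ∈ P, 1 + -(toComplex w / toComplex z) ∈ Complex.slitPlane := by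
    intro w hw
    apply Complex.mem_slitPlane_of_norm_lt_one
    rw [norm_neg, norm_div, div_lt_one hz, hn, hn]
    exact h w hw
  refine ⟨fun w => Complex.log (-toComplex z) + Complex.log (1 + -(toComplex w / toComplex z)),
    continuousOn_const.add (ContinuousOn.clog ?_ hslit), ?_⟩
  · exact continuousOn_const.add (continuous_toComplex.div_const _).neg.continuousOn
  · intro w hw
    rw [Complex.exp_add, Complex.exp_log (neg_ne_zero.2 hz0),
      Complex.exp_log (Complex.slitPlane_ne_zero (hslit w hw))]
    field_simp
    ring

/-- A filled region has no holes, so `w - z` has a continuous logarithm on it for every outer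
point `z`: the set of these `z` is open and closed in the complement and contains all distant
points. -/
theorem IsFilledRegion.hasLogOn {ι : Type*} {u v : ι → Plane} {P : Set Plane}
    (hP : IsFilledRegion u v P) {z : Plane} (hz : z ∉ P) : HasLogOn P z := by
  obtain ⟨X, hX, hzX, hXP, hXb⟩ := hP.exists_unbounded z hz
  obtain ⟨R, hR⟩ := hP.isBounded.exists_norm_le
  obtain ⟨y, hyX, hy⟩ : ∃ y ∈ X, R < ‖y‖ := by
    by_contra! hcon
    exact hXb ((Metric.isBounded_closedBall (x := (0 : Plane)) (r := R)).subset
      fun y hy => by simpa using hcon y hy)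
  have hlog : HasLogOn P y := hasLogOn_of_norm_lt fun w hw => (hR w hw).trans_lt hy
  refine (hX.induction₂ (fun a b => HasLogOn P a ↔ HasLogOn P b) ?_ ?_ ?_ hyX hzX).1 hlog
  · intro a ha
    have haP : a ∈ Pᶜ := Set.disjoint_left.1 hXP ha
    obtain ⟨r, hr, hball⟩ := Metric.isOpen_iff.1 hP.isClosed.isOpen_compl a haP
    have hfar : ∀ w ∈ P, r ≤ dist w a := fun w hw => by
      by_contra! hlt
      exact hball hlt hw
    refine Filter.Eventually.filter_mono nhdsWithin_le_nhds ?_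
    filter_upwards [Metric.ball_mem_nhds a (half_pos hr)] with b hb
    have hb : dist b a < r / 2 := hb
    refine ⟨fun h => h.of_dist_lt fun w hw => ?_, fun h => h.of_dist_lt fun w hw => ?_⟩
    · linarith [hfar w hw]
    · rw [dist_comm]
      linarith [hfar w hw, dist_triangle w b a]
  · intro a b c _ _ _ hab hbc
    exact hab.trans hbc
  · intro a b _ _ hab
    exact hab.symm

/-! ### Slabs between critical abscissae -/

/-- The slope of the line through `a` and `b` (`0` for a vertical line). -/
noncomputable def edgeSlope (a b : Plane) : ℝ := (b 1 - a 1) / (b 0 - a 0)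

/-- The line through `a` and `b` as the graph of an affine function. For a vertical line this is
the horizontal line through `a`, a value that is harmless because vertical segments do not meet
the slabs between critical abscissae. -/
noncomputable def edgeLine (a b : Plane) (x : ℝ) : ℝ := a 1 + (x - a 0) * edgeSlope a b

/-- The critical abscissae of a family of segments: those of the end points and those where two of
the spanned lines cross. -/
def criticalSet {ι : Type*} (u v : ι → Plane) : Set ℝ :=
  Set.range (fun i => u i 0) ∪ Set.range (fun i => v i 0) ∪
    Set.range fun p : ι × ι => (edgeLine (u p.2) (v p.2) 0 - edgeLine (u p.1) (v p.1) 0) /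
      (edgeSlope (u p.1) (v p.1) - edgeSlope (u p.2) (v p.2))

theorem finite_criticalSet {ι : Type*} [Finite ι] (u v : ι → Plane) :
    (criticalSet u v).Finite :=
  ((Set.finite_range _).union (Set.finite_range _)).union (Set.finite_range _)

theorem edgeLine_eq (a b : Plane) (x : ℝ) :
    edgeLine a b x = edgeLine a b 0 + edgeSlope a b * x := by
  unfold edgeLine; ring

theorem continuous_edgeLine (a b : Plane) : Continuous (edgeLine a b) := by
  unfold edgeLine; fun_prop

theorem edgeLine_combo (a b : Plane) {s t x y : ℝ} (hst : s + t = 1) :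
    edgeLine a b (s * x + t * y) = s * edgeLine a b x + t * edgeLine a b y := by
  rw [edgeLine_eq, edgeLine_eq a b x, edgeLine_eq a b y]
  linear_combination (-edgeLine a b 0) * hst

theorem plane_ext {p q : Plane} (h0 : p 0 = q 0) (h1 : p 1 = q 1) : p = q := by
  ext i; fin_cases i <;> assumption

theorem continuous_coord (i : Fin 2) : Continuous fun p : Plane => p i := by fun_prop

theorem continuous_vertical (x : ℝ) : Continuous fun y : ℝ => (!₂[x, y] : Plane) := by
  refine (PiLp.continuous_toLp 2 _).comp (continuous_pi fun i => ?_)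
  fin_cases i
  · exact continuous_const
  · exact continuous_id

section Slab

variable {ι : Type*} {u v : ι → Plane} {P : Set Plane}

/-- Two of the lines keep their order within a slab. -/
theorem edgeLine_lt_edgeLine {x x' : ℝ} (hx : Set.uIcc x x' ⊆ (criticalSet u v)ᶜ) {i j : ι}
    (h : edgeLine (u i) (v i) x < edgeLine (u j) (v j) x) :
    edgeLine (u i) (v i) x' < edgeLine (u j) (v j) x' := by
  by_contra! hcon
  set t := (edgeLine (u j) (v j) 0 - edgeLine (u i) (v i) 0) /
      (edgeSlope (u i) (v i) - edgeSlope (u j) (v j)) with ht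
  have htC : t ∈ criticalSet u v := Or.inr ⟨(i, j), rfl⟩
  refine hx ?_ htC
  rw [edgeLine_eq (u i) (v i) x, edgeLine_eq (u j) (v j) x] at h
  rw [edgeLine_eq (u i) (v i) x', edgeLine_eq (u j) (v j) x'] at hcon
  rcases lt_trichotomy (edgeSlope (u i) (v i) - edgeSlope (u j) (v j)) 0 with hB | hB | hB
  · rw [Set.mem_uIcc]
    right
    constructor
    · rw [ht, le_div_iff_of_neg hB]; linarith
    · rw [ht, div_le_iff_of_neg hB]; linarith
  · exfalso
    have : edgeSlope (u i) (v i) = edgeSlope (u j) (v j) := by linarith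
    rw [this] at h hcon
    linarith
  · rw [Set.mem_uIcc]
    left
    constructor
    · rw [ht, le_div_iff₀ hB]; linarith
    · rw [ht, div_le_iff₀ hB]; linarith

theorem edgeLine_lt_edgeLine_iff {x x' : ℝ} (hx : Set.uIcc x x' ⊆ (criticalSet u v)ᶜ) {i j : ι} :
    edgeLine (u i) (v i) x < edgeLine (u j) (v j) x ↔
      edgeLine (u i) (v i) x' < edgeLine (u j) (v j) x' :=
  ⟨edgeLine_lt_edgeLine hx, edgeLine_lt_edgeLine (by rwa [Set.uIcc_comm])⟩

theorem eq_edgeLine_of_mem_segment {q : Plane} {i : ι} (hq : q ∈ segment ℝ (u i) (v i))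
    (hC : q 0 ∉ criticalSet u v) : q 1 = edgeLine (u i) (v i) (q 0) := by
  obtain ⟨a, b, ha, hb, hab, rfl⟩ := hq
  simp only [PiLp.add_apply, PiLp.smul_apply, smul_eq_mul] at hC ⊢
  have hne : v i 0 - u i 0 ≠ 0 := by
    intro h0
    apply hC
    left; left
    refine ⟨i, ?_⟩
    have : v i 0 = u i 0 := by linarith
    simp only
    rw [this, ← add_mul, hab, one_mul]
  have ha' : a = 1 - b := by linarith
  subst ha'
  unfold edgeLine edgeSlope
  field_simp
  ring

theorem mem_segment_of_eq_edgeLine {q r : Plane} {i : ι} (hq : q ∈ segment ℝ (u i) (v i))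
    (hC : Set.uIcc (q 0) (r 0) ⊆ (criticalSet u v)ᶜ) (hr : r 1 = edgeLine (u i) (v i) (r 0)) :
    r ∈ segment ℝ (u i) (v i) := by
  have hu : u i 0 ∉ Set.uIcc (q 0) (r 0) := fun h => hC h (Or.inl (Or.inl ⟨i, rfl⟩))
  have hv : v i 0 ∉ Set.uIcc (q 0) (r 0) := fun h => hC h (Or.inl (Or.inr ⟨i, rfl⟩))
  obtain ⟨a, b, ha, hb, hab, rfl⟩ := hq
  simp only [PiLp.add_apply, PiLp.smul_apply, smul_eq_mul, Set.mem_uIcc, not_or, not_and,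
    not_le] at hu hv
  have ha' : a = 1 - b := by linarith
  subst ha'
  have key : v i 0 - u i 0 ≠ 0 ∧ 0 ≤ (r 0 - u i 0) / (v i 0 - u i 0) ∧
      (r 0 - u i 0) / (v i 0 - u i 0) ≤ 1 := by
    rcases lt_trichotomy (u i 0) (v i 0) with h | h | h
    · have hpos : 0 < v i 0 - u i 0 := by linarith
      rw [div_le_one hpos]
      refine ⟨hpos.ne', div_nonneg ?_ hpos.le, ?_⟩
      · by_contra! hcon
        have := hu.2 (by linarith)
        nlinarith
      · by_contra! hcon
        have := hv.1 (by nlinarith)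
        linarith
    · rw [← h] at hu
      exfalso
      rcases le_total (u i 0) (r 0) with h1 | h1
      · have := hu.1 (by linarith)
        linarith
      · have := hu.2 h1
        linarith
    · have hneg : v i 0 - u i 0 < 0 := by linarith
      refine ⟨hneg.ne, div_nonneg_of_nonpos ?_ hneg.le, ?_⟩
      · by_contra! hcon
        have := hu.1 (by nlinarith)
        linarith
      · rw [div_le_one_of_neg hneg]
        by_contra! hcon
        have := hv.2 (by linarith)
        nlinarith
  obtain ⟨hne, h0, h1⟩ := key
  refine ⟨1 - (r 0 - u i 0) / (v i 0 - u i 0), (r 0 - u i 0) / (v i 0 - u i 0), by linarith, h0,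
    by ring, plane_ext ?_ ?_⟩
  · simp only [PiLp.add_apply, PiLp.smul_apply, smul_eq_mul]
    field_simp
    ring
  · simp only [PiLp.add_apply, PiLp.smul_apply, smul_eq_mul]
    rw [hr]
    unfold edgeLine edgeSlope
    field_simp
    ring

/-- The points `q` and `r` lie on the same side of each of the lines. -/
def SameSides (u v : ι → Plane) (q r : Plane) : Prop :=
  ∀ i, (edgeLine (u i) (v i) (q 0) < q 1 ↔ edgeLine (u i) (v i) (r 0) < r 1) ∧
    (q 1 < edgeLine (u i) (v i) (q 0) ↔ r 1 < edgeLine (u i) (v i) (r 0))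

/-- Within a slab, membership in the region depends only on the position relative to the lines. -/
theorem IsFilledRegion.mem_of_sameSides (hP : IsFilledRegion u v P) {q r : Plane} (hq : q ∈ P)
    (hC : Set.uIcc (q 0) (r 0) ⊆ (criticalSet u v)ᶜ) (h : SameSides u v q r) : r ∈ P := by
  by_cases hd : ∀ i, Disjoint (segment ℝ q r) (segment ℝ (u i) (v i))
  · exact hP.subset_of_isPreconnected _ (convex_segment q r).isPreconnected hd
      ⟨q, left_mem_segment ℝ q r, hq⟩ (right_mem_segment ℝ q r)
  push Not at hd
  obtain ⟨i, hi⟩ := hd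
  obtain ⟨w, hw, hwe⟩ := Set.not_disjoint_iff.1 hi
  have hw' := hw
  obtain ⟨a, b, ha, hb, hab, rfl⟩ := hw
  have hw0 : (a • q + b • r) 0 ∈ Set.uIcc (q 0) (r 0) := by
    simp only [PiLp.add_apply, PiLp.smul_apply]
    exact (convex_uIcc _ _) Set.left_mem_uIcc Set.right_mem_uIcc ha hb hab
  have hline := eq_edgeLine_of_mem_segment hwe (hC hw0)
  refine hP.segment_subset i (mem_segment_of_eq_edgeLine hwe
    ((Set.uIcc_subset_uIcc hw0 Set.right_mem_uIcc).trans hC) ?_)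
  simp only [PiLp.add_apply, PiLp.smul_apply, smul_eq_mul] at hline
  rw [edgeLine_combo _ _ hab] at hline
  obtain ⟨h1, h2⟩ := h i
  rcases lt_trichotomy (r 1) (edgeLine (u i) (v i) (r 0)) with h3 | h3 | h3
  · exfalso
    have h4 := h2.2 h3
    rcases ha.eq_or_lt with rfl | ha
    · have : b = 1 := by linarith
      subst this
      linarith
    · nlinarith [mul_le_mul_of_nonneg_left h3.le hb]
  · exact h3
  · exfalso
    have h4 := h1.2 h3
    rcases ha.eq_or_lt with rfl | ha
    · have : b = 1 := by linarith
      subst this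
      linarith
    · nlinarith [mul_le_mul_of_nonneg_left h3.le hb]

/-- Each position relative to the lines is realised over every abscissa of the slab. -/
theorem exists_sameSides [Finite ι] (q : Plane) {x : ℝ}
    (hx : Set.uIcc (q 0) x ⊆ (criticalSet u v)ᶜ) : ∃ y, SameSides u v q !₂[x, y] := by
  by_cases hj : ∃ j, q 1 = edgeLine (u j) (v j) (q 0)
  · obtain ⟨j, hj⟩ := hj
    refine ⟨edgeLine (u j) (v j) x, fun i => ?_⟩
    simp only [hj]
    exact ⟨edgeLine_lt_edgeLine_iff hx, edgeLine_lt_edgeLine_iff hx⟩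
  push Not at hj
  have := Fintype.ofFinite ι
  classical
  obtain ⟨y, hy1, hy2⟩ := Order.exists_between_finsets
    ((Finset.univ.filter fun i => edgeLine (u i) (v i) (q 0) < q 1).image
      fun i => edgeLine (u i) (v i) x)
    ((Finset.univ.filter fun i => q 1 < edgeLine (u i) (v i) (q 0)).image
      fun i => edgeLine (u i) (v i) x) (by
    simp only [Finset.mem_image, Finset.mem_filter, Finset.mem_univ, true_and]
    rintro _ ⟨i, hi, rfl⟩ _ ⟨j, hj, rfl⟩
    exact edgeLine_lt_edgeLine hx (hi.trans hj))
  simp only [Finset.mem_image, Finset.mem_filter, Finset.mem_univ, true_and,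
    forall_exists_index, and_imp, forall_apply_eq_imp_iff₂] at hy1 hy2
  refine ⟨y, fun i => ?_⟩
  simp only [Matrix.cons_val_zero, Matrix.cons_val_one]
  rcases (hj i).lt_or_gt with h | h
  · have := hy2 i h
    exact ⟨⟨fun h' => absurd h' h.not_gt, fun h' => absurd h' this.not_gt⟩, fun _ => this, fun _ => h⟩
  · have := hy1 i h
    exact ⟨⟨fun _ => this, fun _ => h⟩, fun h' => absurd h' h.not_gt, fun h' => absurd h' this.not_gt⟩

end Slab

/-! ### Cells of the vertical decomposition -/

section Cell

variable {ι : Type*} {u v : ι → Plane} {P : Set Plane}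

theorem mem_slab_trans {C : Set ℝ} {x y z : ℝ} (hxy : Set.uIcc x y ⊆ Cᶜ)
    (hyz : Set.uIcc y z ⊆ Cᶜ) : Set.uIcc x z ⊆ Cᶜ :=
  Set.uIcc_subset_uIcc_union_uIcc.trans (Set.union_subset hxy hyz)

theorem exists_ball_slab {C : Set ℝ} (hC : IsClosed C) {x : ℝ} (hx : x ∉ C) :
    ∃ r > 0, ∀ y, dist y x < r → Set.uIcc x y ⊆ Cᶜ := by
  obtain ⟨r, hr, hball⟩ := Metric.isOpen_iff.1 hC.isOpen_compl x hx
  refine ⟨r, hr, fun y hy => ?_⟩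
  have : (Metric.ball x r).OrdConnected := (convex_ball x r).ordConnected
  exact (this.uIcc_subset (Metric.mem_ball_self hr) hy).trans hball

/-- A point of the region off the segments is an interior point. -/
theorem IsFilledRegion.mem_nhds [Finite ι] (hP : IsFilledRegion u v P) {p : Plane} (hp : p ∈ P)
    (h : ∀ i, p ∉ segment ℝ (u i) (v i)) : P ∈ nhds p := by
  have hcl : IsClosed (⋃ i, segment ℝ (u i) (v i)) := isClosed_iUnion_of_finite fun i => by
    rw [segment_eq_image_lineMap]
    exact (isCompact_Icc.image (AffineMap.continuous_of_finiteDimensional _)).isClosed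
  have hp' : p ∈ (⋃ i, segment ℝ (u i) (v i))ᶜ := by simpa using h
  obtain ⟨r, hr, hball⟩ := Metric.isOpen_iff.1 hcl.isOpen_compl p hp'
  refine Filter.mem_of_superset (Metric.ball_mem_nhds p hr) ?_
  refine hP.subset_of_isPreconnected _ (convex_ball p r).isPreconnected (fun i => ?_)
    ⟨p, Metric.mem_ball_self hr, hp⟩
  exact (Set.disjoint_left.2 fun q hq hqi => hball hq (Set.mem_iUnion.2 ⟨i, hqi⟩))

/-- Going down (`σ = 1`) or up (`σ = -1`) from a point `p` of the region over a non-critical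
abscissa, the first exit from the region happens on one of the lines, and the region is not
entered again before the next line. -/
theorem IsFilledRegion.exists_exit [Finite ι] (hP : IsFilledRegion u v P) {p : Plane}
    (hp : p ∈ P) (hC : p 0 ∉ criticalSet u v) {σ : ℝ} (hσ : σ = 1 ∨ σ = -1) :
    ∃ e, σ * edgeLine (u e) (v e) (p 0) ≤ σ * p 1 ∧
      (∀ s, σ * edgeLine (u e) (v e) (p 0) ≤ s → s ≤ σ * p 1 → !₂[p 0, σ * s] ∈ P) ∧
      ∀ s < σ * edgeLine (u e) (v e) (p 0),
        (∀ i, σ * edgeLine (u i) (v i) (p 0) < σ * edgeLine (u e) (v e) (p 0) →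
          σ * edgeLine (u i) (v i) (p 0) < s) → !₂[p 0, σ * s] ∉ P := by
  have hσσ : ∀ t : ℝ, σ * (σ * t) = t := fun t => by rcases hσ with rfl | rfl <;> ring
  have hpp : (!₂[p 0, σ * (σ * p 1)] : Plane) = p := by
    rw [hσσ]
    exact plane_ext (by simp) (by simp)
  set N : Set ℝ := {s | s ≤ σ * p 1 ∧ !₂[p 0, σ * s] ∉ P} with hN
  have hcont : Continuous fun s : ℝ => (!₂[p 0, σ * s] : Plane) :=
    (continuous_vertical (p 0)).comp (continuous_const.mul continuous_id)
  have hNne : N.Nonempty := by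
    obtain ⟨R, hR⟩ := hP.isBounded.exists_norm_le
    refine ⟨min (σ * p 1) (-(|R| + 1)), min_le_left _ _, fun hmem => ?_⟩
    have h1 := hR _ hmem
    have h2 := PiLp.norm_apply_le (!₂[p 0, σ * min (σ * p 1) (-(|R| + 1))] : Plane) 1
    simp only [Matrix.cons_val_one, Matrix.cons_val_fin_one, Real.norm_eq_abs, abs_mul] at h2
    have h3 : |σ| = 1 := by rcases hσ with rfl | rfl <;> simp
    have h4 : |R| + 1 ≤ |min (σ * p 1) (-(|R| + 1))| := by
      rw [le_abs]; right
      linarith [min_le_right (σ * p 1) (-(|R| + 1))]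
    rw [h3, one_mul] at h2
    linarith [le_abs_self R]
  have hNbdd : BddAbove N := ⟨σ * p 1, fun s hs => hs.1⟩
  set c := sSup N with hc
  have hcp : c ≤ σ * p 1 := csSup_le hNne fun s hs => hs.1
  have habove : ∀ s, c < s → s ≤ σ * p 1 → !₂[p 0, σ * s] ∈ P := by
    intro s hcs hsp
    by_contra hcon
    exact absurd (le_csSup hNbdd ⟨hsp, hcon⟩) (not_le.2 hcs)
  have hcP : !₂[p 0, σ * c] ∈ P := by
    rcases hcp.eq_or_lt with h | h
    · rw [h, hpp]; exact hp
    by_contra hcon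
    have hev : ∀ᶠ s in nhds c, !₂[p 0, σ * s] ∉ P :=
      hcont.continuousAt.eventually (hP.isClosed.isOpen_compl.mem_nhds hcon)
    have hev2 : ∀ᶠ s in nhdsWithin c (Set.Ioi c), s < σ * p 1 :=
      Filter.Eventually.filter_mono nhdsWithin_le_nhds (eventually_lt_nhds h)
    obtain ⟨s, ⟨hs1, hs2⟩, hs3⟩ :=
      ((hev.filter_mono nhdsWithin_le_nhds).and hev2 |>.and self_mem_nhdsWithin).exists
    exact hs1 (habove s hs3 hs2.le)
  have hedge : ∃ e, !₂[p 0, σ * c] ∈ segment ℝ (u e) (v e) := by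
    by_contra! hcon
    have hev : ∀ᶠ s in nhds c, !₂[p 0, σ * s] ∈ P :=
      hcont.continuousAt.eventually (hP.mem_nhds hcP hcon)
    obtain ⟨l, hl, hlc⟩ := exists_Ioc_subset_of_mem_nhds hev ⟨c - 1, by linarith⟩
    have : c ≤ l := csSup_le hNne fun s hs => by
      by_contra! hls
      exact hs.2 (hlc ⟨hls, le_csSup hNbdd hs⟩)
    linarith
  obtain ⟨e, he⟩ := hedge
  have hec : σ * edgeLine (u e) (v e) (p 0) = c := by
    have := eq_edgeLine_of_mem_segment he (by simpa using hC)
    simp only [Matrix.cons_val_one, Matrix.cons_val_zero, Matrix.cons_val_fin_one] at this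
    rw [← this, hσσ]
  refine ⟨e, ?_⟩
  rw [hec]
  refine ⟨hcp, fun s hs hsp => ?_, fun s hs hlow hmem => ?_⟩
  · rcases hs.eq_or_lt with rfl | hs
    · exact hcP
    · exact habove s hs hsp
  -- All points between `s` and `c` have the same position relative to the lines.
  have hall : ∀ s', s ≤ s' → s' < c → !₂[p 0, σ * s'] ∈ P := by
    intro s' hss hsc
    refine hP.mem_of_sameSides hmem (by simpa using hC) fun i => ?_
    have hi := hlow i
    simp only [Matrix.cons_val_one, Matrix.cons_val_zero, Matrix.cons_val_fin_one]
    rcases lt_or_ge (σ * edgeLine (u i) (v i) (p 0)) c with h | h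
    · have := hi h
      rcases hσ with rfl | rfl
      · constructor <;> constructor <;> intro <;> linarith
      · constructor <;> constructor <;> intro <;> linarith
    · rcases hσ with rfl | rfl
      · constructor <;> constructor <;> intro <;> linarith
      · constructor <;> constructor <;> intro <;> linarith
  have : c ≤ s := csSup_le hNne fun n hn => by
    by_contra! hsn
    rcases (le_csSup hNbdd hn).eq_or_lt with h | h
    · exact hn.2 (by rw [h]; exact hcP)
    · exact hn.2 (hall n hsn.le h)
  linarith

/-- A cell over a slab between critical abscissae: a convex, relatively open part of the region
that is also relatively closed over the slab. The field `gap` provides a vertical line crossing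
the cell together with outer points `lo` and `hi` directly below and above the cell. -/
structure IsCell (P : Set Plane) (C : Set ℝ) (T : Set Plane) : Prop where
  convex : Convex ℝ T
  subset : T ⊆ P
  isOpen : ∃ O, IsOpen O ∧ O ∩ P = T
  mem_of_mem_closure : ∀ q ∈ closure T, q 0 ∉ C → q ∈ T
  notMem : ∀ q ∈ T, q 0 ∉ C
  gap : ∃ m lo hi : ℝ, (∃ q ∈ T, q 0 = m) ∧ !₂[m, lo] ∉ P ∧ !₂[m, hi] ∉ P ∧
    (∀ q ∈ P, q 0 = m → lo ≤ q 1 → q 1 ≤ hi → q ∈ T) ∧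
    ∀ q ∈ T, q 0 = m → lo < q 1 ∧ q 1 < hi

theorem exists_lt_forall_lt {ι : Type*} [Finite ι] (f : ι → ℝ) (c : ℝ) :
    ∃ y < c, ∀ i, f i < c → f i < y := by
  have h : ∀ᶠ y in nhdsWithin c (Set.Iio c), ∀ i, f i < c → f i < y := by
    rw [Filter.eventually_all]
    intro i
    by_cases hi : f i < c
    · filter_upwards [Filter.Eventually.filter_mono nhdsWithin_le_nhds (eventually_gt_nhds hi)]
        with y hy _ using hy
    · exact Filter.Eventually.of_forall fun y h => absurd h hi
  obtain ⟨y, hy, hyc⟩ := (h.and self_mem_nhdsWithin).exists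
  exact ⟨y, hyc, hy⟩

/-- Every point of the region over a non-critical abscissa lies in a cell: the part of the slab
between the lines through the two ends of the vertical section through that point. -/
theorem IsFilledRegion.exists_isCell [Finite ι] (hP : IsFilledRegion u v P) {p : Plane}
    (hp : p ∈ P) (hC : p 0 ∉ criticalSet u v) : ∃ T, IsCell P (criticalSet u v) T ∧ p ∈ T := by
  have hCcl : IsClosed (criticalSet u v) := (finite_criticalSet u v).isClosed
  obtain ⟨e, he1, he2, he3⟩ := hP.exists_exit hp hC (Or.inl rfl)
  obtain ⟨f, hf1, hf2, hf3⟩ := hP.exists_exit hp hC (Or.inr rfl)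
  simp only [one_mul, neg_mul, neg_le_neg_iff, neg_lt_neg_iff] at he1 he2 he3 hf1 hf2 hf3
  set m := p 0 with hm
  set C := criticalSet u v
  set ℓ : ι → ℝ → ℝ := fun i => edgeLine (u i) (v i) with hℓ
  change ℓ e m ≤ p 1 at he1
  change p 1 ≤ ℓ f m at hf1
  have hin : ∀ y, ℓ e m ≤ y → y ≤ ℓ f m → !₂[m, y] ∈ P := by
    intro y h1 h2
    rcases le_total y (p 1) with h | h
    · exact he2 y h1 h
    · have := hf2 (-y) (by simpa using h2) (by simpa using h)
      simpa using this
  have hlow : ∀ y < ℓ e m, (∀ i, ℓ i m < ℓ e m → ℓ i m < y) → !₂[m, y] ∉ P := he3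
  have hup : ∀ y > ℓ f m, (∀ i, ℓ f m < ℓ i m → y < ℓ i m) → !₂[m, y] ∉ P := by
    intro y hy h
    have := hf3 (-y) (by simpa using hy) fun i hi => neg_lt_neg (h i hi)
    simpa using this
  have hmm : Set.uIcc m m ⊆ Cᶜ := by simpa using hC
  have hsym : ∀ {x y : ℝ}, Set.uIcc x y ⊆ Cᶜ → Set.uIcc y x ⊆ Cᶜ := fun h => by
    rwa [Set.uIcc_comm]
  set T : Set Plane := {q | Set.uIcc m (q 0) ⊆ Cᶜ ∧ ℓ e (q 0) ≤ q 1 ∧ q 1 ≤ ℓ f (q 0)} with hT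
  have hTP : T ⊆ P := by
    rintro q ⟨hq0, hq1, hq2⟩
    obtain ⟨y, hy⟩ := exists_sameSides q (hsym hq0)
    have hy' : SameSides u v !₂[m, y] q := fun i => ⟨(hy i).1.symm, (hy i).2.symm⟩
    refine hP.mem_of_sameSides (hin y ?_ ?_) (by simpa using hq0) hy'
    · by_contra! hcon
      exact absurd ((hy e).2.2 (by simpa using hcon)) (not_lt.2 hq1)
    · by_contra! hcon
      exact absurd ((hy f).1.2 (by simpa using hcon)) (not_lt.2 hq2)
  have hnear : ∀ q ∈ P, Set.uIcc m (q 0) ⊆ Cᶜ → (∀ i, ℓ i m < ℓ e m → ℓ i (q 0) < q 1) →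
      (∀ i, ℓ f m < ℓ i m → q 1 < ℓ i (q 0)) → q ∈ T := by
    intro q hqP hq0 h1 h2
    obtain ⟨y, hy⟩ := exists_sameSides q (hsym hq0)
    have hyP : !₂[m, y] ∈ P := hP.mem_of_sameSides hqP (by simpa using hsym hq0) hy
    refine ⟨hq0, ?_, ?_⟩
    · by_contra! hcon
      refine hlow y (by simpa using (hy e).2.1 hcon) (fun i hi => ?_) hyP
      simpa using (hy i).1.1 (h1 i hi)
    · by_contra! hcon
      refine hup y (by simpa using (hy f).1.1 hcon) (fun i hi => ?_) hyP
      simpa using (hy i).2.1 (h2 i hi)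
  have hslab : IsOpen {x | Set.uIcc m x ⊆ Cᶜ} := by
    rw [Metric.isOpen_iff]
    intro x hx
    obtain ⟨r, hr, h⟩ := exists_ball_slab hCcl (hx Set.right_mem_uIcc)
    exact ⟨r, hr, fun y hy => mem_slab_trans hx (h y hy)⟩
  have hcoord0 := continuous_coord 0
  have hcoord1 := continuous_coord 1
  have hline : ∀ i, Continuous fun q : Plane => ℓ i (q 0) := fun i =>
    (continuous_edgeLine (u i) (v i)).comp hcoord0
  refine ⟨T, ⟨?_, hTP, ?_, ?_, fun q hq => hq.1 Set.right_mem_uIcc, ?_⟩, hmm, he1, hf1⟩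
  · rintro q ⟨hq0, hq1, hq2⟩ r ⟨hr0, hr1, hr2⟩ a b ha hb hab
    simp only [hT, Set.mem_ofPred_eq, PiLp.add_apply, PiLp.smul_apply, smul_eq_mul, hℓ]
    refine ⟨?_, ?_, ?_⟩
    · have hconv : Convex ℝ (Set.ordConnectedComponent Cᶜ m) := Set.OrdConnected.convex inferInstance
      exact hconv hq0 hr0 ha hb hab
    · rw [edgeLine_combo _ _ hab]
      exact add_le_add (mul_le_mul_of_nonneg_left hq1 ha) (mul_le_mul_of_nonneg_left hr1 hb)
    · rw [edgeLine_combo _ _ hab]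
      exact add_le_add (mul_le_mul_of_nonneg_left hq2 ha) (mul_le_mul_of_nonneg_left hr2 hb)
  · refine ⟨{q | Set.uIcc m (q 0) ⊆ Cᶜ} ∩ ((⋂ i, {q | ℓ i m < ℓ e m → ℓ i (q 0) < q 1}) ∩
      ⋂ i, {q | ℓ f m < ℓ i m → q 1 < ℓ i (q 0)}), ?_, ?_⟩
    · refine (hslab.preimage hcoord0).inter ((isOpen_iInter_of_finite fun i => ?_).inter
        (isOpen_iInter_of_finite fun i => ?_))
      · by_cases h : ℓ i m < ℓ e m
        · simpa [h] using isOpen_lt (hline i) hcoord1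
        · simp [h]
      · by_cases h : ℓ f m < ℓ i m
        · simpa [h] using isOpen_lt hcoord1 (hline i)
        · simp [h]
    · apply Set.Subset.antisymm
      · rintro q ⟨⟨h0, h1, h2⟩, hqP⟩
        rw [Set.mem_iInter] at h1 h2
        exact hnear q hqP h0 h1 h2
      · intro q hq
        refine ⟨⟨hq.1, Set.mem_iInter.2 fun i hi => ?_, Set.mem_iInter.2 fun i hi => ?_⟩, hTP hq⟩
        · exact (edgeLine_lt_edgeLine hq.1 hi).trans_le hq.2.1
        · exact hq.2.2.trans_lt (edgeLine_lt_edgeLine hq.1 hi)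
  · intro q hq hqC
    obtain ⟨r, hr, h⟩ := exists_ball_slab hCcl hqC
    have hnb : {w : Plane | dist (w 0) (q 0) < r} ∈ nhds q :=
      hcoord0.continuousAt.eventually (Metric.ball_mem_nhds (q 0) hr)
    obtain ⟨w, hw1, hw2⟩ := mem_closure_iff_nhds.1 hq _ hnb
    refine ⟨mem_slab_trans hw2.1 (hsym (h _ hw1)), ?_, ?_⟩
    · have hcl : IsClosed {q : Plane | ℓ e (q 0) ≤ q 1} := isClosed_le (hline e) hcoord1
      exact closure_minimal (fun w hw => hw.2.1) hcl hq
    · have hcl : IsClosed {q : Plane | q 1 ≤ ℓ f (q 0)} := isClosed_le hcoord1 (hline f)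
      exact closure_minimal (fun w hw => hw.2.2) hcl hq
  · obtain ⟨lo, hlo, hlo'⟩ := exists_lt_forall_lt (fun i => ℓ i m) (ℓ e m)
    obtain ⟨hi, hhi, hhi'⟩ := exists_lt_forall_lt (fun i => -ℓ i m) (-ℓ f m)
    refine ⟨m, lo, -hi, ⟨p, ⟨hmm, he1, hf1⟩, rfl⟩, hlow lo hlo hlo', hup (-hi) (by linarith)
      (fun i h => ?_), fun q hqP hq0 h1 h2 => ?_, fun q hq hq0 => ?_⟩
    · have := hhi' i (by linarith)
      linarith
    · refine hnear q hqP (by rw [hq0]; exact hmm) (fun i h => ?_) (fun i h => ?_)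
      · rw [hq0]; exact (hlo' i h).trans_le h1
      · rw [hq0]
        have := hhi' i (by linarith)
        linarith
    · obtain ⟨-, h1, h2⟩ := hq
      rw [hq0] at h1 h2
      constructor <;> linarith

end Cell

/-! ### A cell separates its two sides -/

theorem IsPreconnected.eq_of_forall_exists_int {s : Set Plane} (hs : IsPreconnected s)
    {f : Plane → ℝ} (hf : ContinuousOn f s) {a : ℝ}
    (h : ∀ x ∈ s, ∃ n : ℤ, f x = a + 2 * Real.pi * n) {x y : Plane} (hx : x ∈ s) (hy : y ∈ s) :
    f x = f y := by
  suffices H : ∀ x ∈ s, ∀ y ∈ s, ¬ f x < f y from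
    le_antisymm (not_lt.1 (H y hy x hx)) (not_lt.1 (H x hx y hy))
  intro x hx y hy hlt
  have hpi := Real.pi_pos
  obtain ⟨n, hn⟩ := h x hx
  obtain ⟨n', hn'⟩ := h y hy
  have hnn : n + 1 ≤ n' := by
    have : (n : ℝ) < n' := by
      by_contra! hcon
      nlinarith
    exact_mod_cast this
  have hnn' : (n : ℝ) + 1 ≤ n' := by exact_mod_cast hnn
  obtain ⟨z, hz, hfz⟩ := hs.intermediate_value hx hy hf
    (show f x + Real.pi ∈ Set.Icc (f x) (f y) from ⟨by linarith, by nlinarith⟩)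
  obtain ⟨k, hk⟩ := h z hz
  have h2 : (2 : ℝ) * k = 2 * n + 1 := by
    have : Real.pi * (2 * k) = Real.pi * (2 * n + 1) := by linarith
    exact mul_left_cancel₀ hpi.ne' this
  have h3 : 2 * k = 2 * n + 1 := by exact_mod_cast h2
  omega

theorem IsPreconnected.subset_of_closed_partition {X A B : Set Plane} (hX : IsPreconnected X)
    (hA : IsClosed A) (hB : IsClosed B) (hAB : Disjoint A B) (hsub : X ⊆ A ∪ B)
    (h : (X ∩ B).Nonempty) : X ⊆ B := by
  rcases isPreconnected_iff_subset_of_disjoint_closed.1 hX A B hA hB hsub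
    (by rw [hAB.inter_eq, Set.inter_empty]) with h1 | h1
  · obtain ⟨q, hq, hqB⟩ := h
    exact absurd hqB (Set.disjoint_left.1 hAB (h1 hq))
  · exact h1

section Separation

variable {ι : Type*} {u v : ι → Plane} {P T : Set Plane} {C : Set ℝ}

theorem IsCell.isClosed_diff (hT : IsCell P C T) (hP : IsClosed P) : IsClosed (P \ T) := by
  obtain ⟨O, hO, hOT⟩ := hT.isOpen
  have : P \ T = P \ O := by
    rw [← hOT]
    ext q
    simp only [Set.mem_sdiff, Set.mem_inter_iff]
    tauto
  rw [this]
  exact hP.sdiff hO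

/-- The sections of `P` on the two sides of a cell cannot be joined in `P` without crossing the
cell. With `z` and `z'` the outer points below and above the cell, the argument of
`(w - z') / (w - z)` has a continuous branch on the whole of `P`. The principal argument is
continuous off the vertical segment from `z` to `z'`, which meets `P` only inside the cell, and it
jumps by `2π` across that segment. Hence the difference of the two is locally constant on `P`
outside the cell and takes different values at the two sides of the cell. -/
theorem IsFilledRegion.exists_separation (hP : IsFilledRegion u v P) (hT : IsCell P C T) :
    ∃ m : ℝ, (∃ q ∈ T, q 0 = m) ∧ ∃ L R : Set Plane, IsClosed L ∧ IsClosed R ∧ Disjoint L R ∧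
      L ∪ R = P \ T ∧ ∀ q ∈ closure T \ T, (q 0 < m ∧ q ∈ L) ∨ (m < q 0 ∧ q ∈ R) := by
  obtain ⟨m, lo, hi, ⟨b, hbT, hbm⟩, hlo, hhi, hgap, hgap'⟩ := hT.gap
  refine ⟨m, ⟨b, hbT, hbm⟩, ?_⟩
  have hlohi : lo < hi := (hgap' b hbT hbm).1.trans (hgap' b hbT hbm).2
  have hmC : m ∉ C := hbm ▸ hT.notMem b hbT
  have hclP : closure T ⊆ P := closure_minimal hT.subset hP.isClosed
  have hpi := Real.pi_pos
  obtain ⟨L₁, hL₁, hexp₁⟩ := hP.hasLogOn hhi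
  obtain ⟨L₂, hL₂, hexp₂⟩ := hP.hasLogOn hlo
  -- `G w` is a positive multiple of `(w - z') / (w - z)`.
  set G : Plane → ℂ := fun w => (toComplex w - toComplex !₂[m, hi]) *
    (starRingEnd ℂ) (toComplex w - toComplex !₂[m, lo]) with hG
  have hGre : ∀ w, (G w).re = (w 0 - m) ^ 2 + (w 1 - hi) * (w 1 - lo) := fun w => by
    simp [hG, Complex.mul_re]; ring
  have hGim : ∀ w, (G w).im = (w 0 - m) * (lo - hi) := fun w => by
    simp [hG, Complex.mul_im]; ring
  have hGcont : Continuous G := by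
    refine (continuous_toComplex.sub continuous_const).mul ?_
    exact Complex.continuous_conj.comp (continuous_toComplex.sub continuous_const)
  set θ : Plane → ℝ := fun w => (L₁ w - L₂ w).im with hθ
  have hθc : ContinuousOn θ P := Complex.continuous_im.comp_continuousOn (hL₁.sub hL₂)
  have hGexp : ∀ w ∈ P, ∃ r : ℝ, G w = Complex.exp (L₁ w - L₂ w + r) := by
    intro w hw
    have hne : toComplex w - toComplex !₂[m, lo] ≠ 0 := by
      rw [← hexp₂ w hw]; exact Complex.exp_ne_zero _
    have hpos : 0 < Complex.normSq (toComplex w - toComplex !₂[m, lo]) := Complex.normSq_pos.2 hne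
    refine ⟨Real.log (Complex.normSq (toComplex w - toComplex !₂[m, lo])), ?_⟩
    rw [Complex.exp_add, Complex.exp_sub, hexp₁ w hw, hexp₂ w hw, ← Complex.ofReal_exp,
      Real.exp_log hpos, ← Complex.mul_conj]
    simp only [hG]
    field_simp
  have hGne : ∀ w ∈ P, G w ≠ 0 := fun w hw => by
    obtain ⟨r, hr⟩ := hGexp w hw
    rw [hr]; exact Complex.exp_ne_zero _
  have harg : ∀ w ∈ P, ∃ n : ℤ, θ w - (G w).arg = 0 + 2 * Real.pi * n := by
    intro w hw
    obtain ⟨r, hr⟩ := hGexp w hw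
    have h1 := Complex.exp_log (hGne w hw)
    nth_rw 2 [hr] at h1
    obtain ⟨n, hn⟩ := Complex.exp_eq_exp_iff_exists_int.1 h1
    refine ⟨-n, ?_⟩
    have := congrArg Complex.im hn
    rw [Complex.log_im] at this
    simp at this
    simp only [hθ, Complex.sub_im]
    push_cast
    linarith
  have harg' : ∀ w ∈ P, ∃ n : ℤ, θ w - (-G w).arg = Real.pi + 2 * Real.pi * n := by
    intro w hw
    obtain ⟨r, hr⟩ := hGexp w hw
    have h1 := Complex.exp_log (neg_ne_zero.2 (hGne w hw))
    have h2 : -G w = Complex.exp (L₁ w - L₂ w + r + Real.pi * Complex.I) := by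
      rw [Complex.exp_add, Complex.exp_pi_mul_I, hr]; ring
    nth_rw 2 [h2] at h1
    obtain ⟨n, hn⟩ := Complex.exp_eq_exp_iff_exists_int.1 h1
    refine ⟨-n - 1, ?_⟩
    have := congrArg Complex.im hn
    rw [Complex.log_im] at this
    simp at this
    simp only [hθ, Complex.sub_im]
    push_cast
    linarith
  have hslit : ∀ w ∈ P \ T, G w ∈ Complex.slitPlane := by
    rintro w ⟨hwP, hwT⟩
    rw [Complex.mem_slitPlane_iff, hGre, hGim]
    by_cases h0 : w 0 = m
    · left
      rw [h0, sub_self]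
      rcases lt_or_ge (w 1) lo with h1 | h1
      · nlinarith [mul_pos (sub_pos.2 h1) (sub_pos.2 (h1.trans hlohi))]
      · rcases lt_or_ge hi (w 1) with h2 | h2
        · nlinarith [mul_pos (sub_pos.2 h2) (sub_pos.2 (hlohi.trans h2))]
        · exact absurd (hgap w hwP h0 h1 h2) hwT
    · right
      exact mul_ne_zero (sub_ne_zero.2 h0) (sub_ne_zero.2 hlohi.ne)
  have hslit' : ∀ w ∈ closure T, -G w ∈ Complex.slitPlane := by
    intro w hw
    rw [Complex.mem_slitPlane_iff, Complex.neg_re, Complex.neg_im, hGre, hGim]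
    by_cases h0 : w 0 = m
    · left
      obtain ⟨h1, h2⟩ := hgap' w (hT.mem_of_mem_closure w hw (by rwa [h0])) h0
      rw [h0, sub_self]
      nlinarith [mul_pos (sub_pos.2 h1) (sub_pos.2 h2)]
    · right
      exact neg_ne_zero.2 (mul_ne_zero (sub_ne_zero.2 h0) (sub_ne_zero.2 hlohi.ne))
  have hhc : ContinuousOn (fun w => θ w - (G w).arg) (P \ T) := by
    refine (hθc.mono Set.sdiff_subset).sub fun w hw => ?_
    exact ((Complex.continuousAt_arg (hslit w hw)).comp hGcont.continuousAt).continuousWithinAt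
  have hkc : ContinuousOn (fun w => θ w - (-G w).arg) (closure T) := by
    refine (hθc.mono hclP).sub fun w hw => ?_
    exact ((Complex.continuousAt_arg (hslit' w hw)).comp
      (f := fun w => -G w) hGcont.neg.continuousAt).continuousWithinAt
  set κ := θ b - (-G b).arg with hκ
  have hconst : ∀ w ∈ closure T, θ w - (-G w).arg = κ := fun w hw =>
    hT.convex.closure.isPreconnected.eq_of_forall_exists_int hkc
      (fun x hx => harg' x (hclP hx)) hw (subset_closure hbT)
  obtain ⟨k, hk⟩ := harg' b (hT.subset hbT)
  have hdich : ∀ w ∈ P, θ w - (G w).arg ≤ κ - Real.pi ∨ κ + Real.pi ≤ θ w - (G w).arg := by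
    intro w hw
    obtain ⟨n, hn⟩ := harg w hw
    rw [hn, hκ, hk]
    rcases le_or_gt n k with h | h
    · left
      have : (n : ℝ) ≤ k := by exact_mod_cast h
      nlinarith
    · right
      have : (k : ℝ) + 1 ≤ n := by exact_mod_cast h
      nlinarith
  have hcl := hT.isClosed_diff hP.isClosed
  refine ⟨(P \ T) ∩ (fun w => θ w - (G w).arg) ⁻¹' Set.Iic (κ - Real.pi),
    (P \ T) ∩ (fun w => θ w - (G w).arg) ⁻¹' Set.Ici (κ + Real.pi),
    hhc.preimage_isClosed_of_isClosed hcl isClosed_Iic,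
    hhc.preimage_isClosed_of_isClosed hcl isClosed_Ici, ?_, ?_, ?_⟩
  · rw [Set.disjoint_left]
    rintro w ⟨-, h1⟩ ⟨-, h2⟩
    simp only [Set.mem_preimage, Set.mem_Iic, Set.mem_Ici] at h1 h2
    linarith
  · rw [← Set.inter_union_distrib_left]
    refine Set.inter_eq_left.2 fun w hw => ?_
    exact hdich w hw.1
  · rintro q ⟨hq, hqT⟩
    have hqm : q 0 ≠ m := fun h => hqT (hT.mem_of_mem_closure q hq (by rwa [h]))
    have hc := hconst q hq
    rcases hqm.lt_or_gt with h | h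
    · refine Or.inl ⟨h, ⟨hclP hq, hqT⟩, ?_⟩
      have him : 0 < (G q).im := by
        rw [hGim]; exact mul_pos_of_neg_of_neg (by linarith) (by linarith)
      rw [Complex.arg_neg_eq_arg_sub_pi_of_im_pos him] at hc
      simp only [Set.mem_preimage, Set.mem_Iic]
      linarith
    · refine Or.inr ⟨h, ⟨hclP hq, hqT⟩, ?_⟩
      have him : (G q).im < 0 := by
        rw [hGim]; exact mul_neg_of_pos_of_neg (by linarith) (by linarith)
      rw [Complex.arg_neg_eq_arg_add_pi_of_im_neg him] at hc
      simp only [Set.mem_preimage, Set.mem_Ici]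
      linarith

end Separation

/-! ### Doors, pieces and their adjacency -/

section Piece

variable {ι : Type*} {u v : ι → Plane} {P : Set Plane} {C : Set ℝ}

theorem mem_segment_iff_of_eq_abscissa {a b z : Plane} (h : a 0 = b 0) :
    z ∈ segment ℝ a b ↔ z 0 = a 0 ∧ z 1 ∈ Set.uIcc (a 1) (b 1) := by
  constructor
  · rintro ⟨s, t, hs, ht, hst, rfl⟩
    simp only [PiLp.add_apply, PiLp.smul_apply]
    refine ⟨?_, (convex_uIcc _ _) Set.left_mem_uIcc Set.right_mem_uIcc hs ht hst⟩
    rw [← h, smul_eq_mul, smul_eq_mul, ← add_mul, hst, one_mul]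
  · rintro ⟨h0, h1⟩
    rw [← segment_eq_uIcc] at h1
    obtain ⟨s, t, hs, ht, hst, hz⟩ := h1
    refine ⟨s, t, hs, ht, hst, plane_ext ?_ ?_⟩
    · simp only [PiLp.add_apply, PiLp.smul_apply, smul_eq_mul]
      rw [← h, ← add_mul, hst, one_mul, h0]
    · simpa only [PiLp.add_apply, PiLp.smul_apply] using hz

/-- A door: a maximal vertical segment of the region over a critical abscissa. -/
structure IsDoor (P : Set Plane) (C : Set ℝ) (D : Set Plane) : Prop where
  convex : Convex ℝ D
  subset : D ⊆ P
  mem : ∀ q ∈ D, q 0 ∈ C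
  vertical : ∀ q ∈ D, ∀ r ∈ D, q 0 = r 0
  maximal : ∀ d ∈ D, ∀ q, q 0 = d 0 → segment ℝ d q ⊆ P → q ∈ D

theorem exists_isDoor {p : Plane} (hp : p ∈ P) (hC : p 0 ∈ C) : ∃ D, IsDoor P C D ∧ p ∈ D := by
  have hsub : ∀ {a b c : Plane}, a 0 = b 0 → b 0 = c 0 → segment ℝ a b ⊆ P →
      segment ℝ b c ⊆ P → segment ℝ a c ⊆ P := by
    intro a b c hab hbc h1 h2 z hz
    rw [mem_segment_iff_of_eq_abscissa (hab.trans hbc)] at hz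
    rcases Set.uIcc_subset_uIcc_union_uIcc (b := b 1) hz.2 with h | h
    · exact h1 ((mem_segment_iff_of_eq_abscissa hab).2 ⟨hz.1, h⟩)
    · exact h2 ((mem_segment_iff_of_eq_abscissa hbc).2 ⟨hz.1.trans hab, h⟩)
  refine ⟨{q | q 0 = p 0 ∧ segment ℝ p q ⊆ P}, ⟨?_, ?_, ?_, ?_, ?_⟩, rfl, by simpa using hp⟩
  · rw [convex_iff_segment_subset]
    rintro q ⟨hq0, hq⟩ r ⟨hr0, hr⟩ w hw
    have hqr : q 0 = r 0 := hq0.trans hr0.symm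
    have hqrP : segment ℝ q r ⊆ P :=
      hsub hq0 hr0.symm (by rwa [segment_symm]) hr
    have hw' := hw
    rw [mem_segment_iff_of_eq_abscissa hqr] at hw'
    refine ⟨hw'.1.trans hq0, hsub hq0.symm hw'.1.symm hq ?_⟩
    exact ((convex_segment q r).segment_subset (left_mem_segment ℝ q r) hw).trans hqrP
  · rintro q ⟨-, hq⟩
    exact hq (right_mem_segment ℝ p q)
  · rintro q ⟨hq, -⟩
    rwa [hq]
  · rintro q ⟨hq, -⟩ r ⟨hr, -⟩
    rw [hq, hr]
  · rintro d ⟨hd0, hd⟩ q hq hdq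
    exact ⟨hq.trans hd0, hsub hd0.symm hq.symm hd hdq⟩

theorem IsDoor.subset_of_mem {D D' : Set Plane} (hD : IsDoor P C D) (hD' : IsDoor P C D')
    {q : Plane} (hq : q ∈ D) (hq' : q ∈ D') : D ⊆ D' := fun r hr =>
  hD'.maximal q hq' r (hD.vertical r hr q hq) ((hD.convex.segment_subset hq hr).trans hD.subset)

theorem IsDoor.eq_of_mem {D D' : Set Plane} (hD : IsDoor P C D) (hD' : IsDoor P C D')
    {q : Plane} (hq : q ∈ D) (hq' : q ∈ D') : D = D' :=
  (hD.subset_of_mem hD' hq hq').antisymm (hD'.subset_of_mem hD hq' hq)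

theorem IsCell.nonempty {T : Set Plane} (hT : IsCell P C T) : T.Nonempty := by
  obtain ⟨_, _, _, ⟨q, hq, -⟩, -⟩ := hT.gap
  exact ⟨q, hq⟩

theorem IsCell.subset_of_isPreconnected {T X : Set Plane} (hT : IsCell P C T)
    (hX : IsPreconnected X) (hXP : X ⊆ P) (hXC : ∀ q ∈ X, q 0 ∉ C) (h : (X ∩ T).Nonempty) :
    X ⊆ T := by
  obtain ⟨O, hO, hOT⟩ := hT.isOpen
  have hOX : ∀ q ∈ X, q ∈ O → q ∈ T := fun q hq hqO => hOT ▸ ⟨hqO, hXP hq⟩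
  have hTO : T ⊆ O := hOT ▸ Set.inter_subset_left
  have hcover : X ⊆ O ∪ (closure T)ᶜ := fun q hq => by
    by_cases hc : q ∈ closure T
    · exact Or.inl (hTO (hT.mem_of_mem_closure q hc (hXC q hq)))
    · exact Or.inr hc
  have hdisj : X ∩ (O ∩ (closure T)ᶜ) = ∅ := by
    rw [Set.eq_empty_iff_forall_notMem]
    rintro q ⟨hq, hqO, hqc⟩
    exact hqc (subset_closure (hOX q hq hqO))
  rcases isPreconnected_iff_subset_of_disjoint.1 hX O (closure T)ᶜ hO
    isClosed_closure.isOpen_compl hcover hdisj with h1 | h1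
  · exact fun q hq => hOX q hq (h1 hq)
  · obtain ⟨q, hq, hqT⟩ := h
    exact absurd (subset_closure hqT) (h1 hq)

theorem IsCell.eq_of_mem {T T' : Set Plane} (hT : IsCell P C T) (hT' : IsCell P C T')
    {q : Plane} (hq : q ∈ T) (hq' : q ∈ T') : T = T' :=
  (hT'.subset_of_isPreconnected hT.convex.isPreconnected hT.subset hT.notMem
    ⟨q, hq, hq'⟩).antisymm
  (hT.subset_of_isPreconnected hT'.convex.isPreconnected hT'.subset hT'.notMem ⟨q, hq', hq⟩)

theorem IsCell.closure_subset {T : Set Plane} (hT : IsCell P C T) (hP : IsClosed P) :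
    closure T ⊆ P := closure_minimal hT.subset hP

/-- The pieces of the vertical decomposition: doors and closed cells. -/
def IsPiece (P : Set Plane) (C : Set ℝ) (K : Set Plane) : Prop :=
  IsDoor P C K ∨ ∃ T, IsCell P C T ∧ K = closure T

/-- A door and a closed cell are adjacent if they meet. -/
def PieceAdj (P : Set Plane) (C : Set ℝ) (K K' : Set Plane) : Prop :=
  (K ∩ K').Nonempty ∧ ((IsDoor P C K ∧ ∃ T, IsCell P C T ∧ K' = closure T) ∨
    (IsDoor P C K' ∧ ∃ T, IsCell P C T ∧ K = closure T))

/-- The piece `K` is joined to a piece containing `y` by `n` adjacency steps. -/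
def Reaches (P : Set Plane) (C : Set ℝ) (y : Plane) : ℕ → Set Plane → Prop
  | 0, K => IsPiece P C K ∧ y ∈ K
  | n + 1, K => ∃ K', PieceAdj P C K K' ∧ Reaches P C y n K'

/-- The piece `K` has distance exactly `n` from the pieces containing `y`. -/
def HasRank (P : Set Plane) (C : Set ℝ) (y : Plane) (n : ℕ) (K : Set Plane) : Prop :=
  Reaches P C y n K ∧ ∀ m < n, ¬ Reaches P C y m K

theorem IsPiece.convex {K : Set Plane} (h : IsPiece P C K) : Convex ℝ K := by
  rcases h with h | ⟨T, hT, rfl⟩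
  · exact h.convex
  · exact hT.convex.closure

theorem IsPiece.subset {K : Set Plane} (h : IsPiece P C K) (hP : IsClosed P) : K ⊆ P := by
  rcases h with h | ⟨T, hT, rfl⟩
  · exact h.subset
  · exact hT.closure_subset hP

theorem PieceAdj.symm {K K' : Set Plane} (h : PieceAdj P C K K') : PieceAdj P C K' K :=
  ⟨by rw [Set.inter_comm]; exact h.1, h.2.symm⟩

theorem PieceAdj.isPiece {K K' : Set Plane} (h : PieceAdj P C K K') : IsPiece P C K := by
  rcases h.2 with h | h
  · exact Or.inl h.1
  · exact Or.inr h.2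

theorem Reaches.isPiece {y : Plane} {n : ℕ} {K : Set Plane} (h : Reaches P C y n K) :
    IsPiece P C K := by
  cases n with
  | zero => exact h.1
  | succ n => exact h.choose_spec.1.isPiece

theorem IsDoor.ne_closure {D T : Set Plane} (hD : IsDoor P C D) (hT : IsCell P C T) :
    D ≠ closure T := by
  rintro rfl
  obtain ⟨q, hq⟩ := hT.nonempty
  exact hT.notMem q hq (hD.mem q (subset_closure hq))

theorem IsPiece.subset_diff {K T : Set Plane} (hK : IsPiece P C K) (hT : IsCell P C T)
    (hP : IsClosed P) (hne : K ≠ closure T) : K ⊆ P \ T := by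
  refine fun q hq => ⟨hK.subset hP hq, fun hqT => ?_⟩
  rcases hK with hD | ⟨T', hT', rfl⟩
  · exact hT.notMem q hqT (hD.mem q hq)
  · exact hne (by rw [hT'.eq_of_mem hT (hT'.mem_of_mem_closure q hq (hT.notMem q hqT)) hqT])

theorem HasRank.exists_adj {y : Plane} {n : ℕ} {K : Set Plane} (h : HasRank P C y (n + 1) K) :
    ∃ K', PieceAdj P C K K' ∧ HasRank P C y n K' := by
  obtain ⟨⟨K', hadj, hK'⟩, hmin⟩ := h
  exact ⟨K', hadj, hK', fun m hm hr => hmin (m + 1) (by omega) ⟨K', hadj, hr⟩⟩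

/-! ### Gates between adjacent pieces -/

/-- A door that meets a closed cell is one of its two sides, and it is separated from the other
side by the cell. -/
theorem IsFilledRegion.exists_partition (hP : IsFilledRegion u v P) {D T : Set Plane}
    (hD : IsDoor P C D) (hT : IsCell P C T) (hDT : (D ∩ closure T).Nonempty) :
    ∃ A B : Set Plane, IsClosed A ∧ IsClosed B ∧ Disjoint A B ∧ A ∪ B = P \ T ∧ D ⊆ A ∧
      closure T ∩ A ⊆ D := by
  obtain ⟨m, ⟨b, hbT, hbm⟩, L, R, hL, hR, hLR, hun, hside⟩ := hP.exists_separation hT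
  obtain ⟨d, hdD, hdT⟩ := hDT
  have hdnT : d ∉ T := fun h => hT.notMem d h (hD.mem d hdD)
  have hDsub : D ⊆ L ∪ R := by
    rw [hun]
    exact IsPiece.subset_diff (Or.inl hD) hT hP.isClosed (hD.ne_closure hT)
  -- No point of the cell lies over the critical abscissa of `d`, so by convexity the cell does not
  -- reach beyond that abscissa as seen from `m`.
  have hcross : ∀ q' ∈ T, d 0 ∉ Set.uIcc (q' 0) m := by
    intro q' hq' hmem
    rw [← segment_eq_uIcc, ← hbm] at hmem
    obtain ⟨s, t, hs, ht, hst, hz⟩ := hmem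
    refine hT.notMem _ (hT.convex hq' hbT hs ht hst) ?_
    simp only [PiLp.add_apply, PiLp.smul_apply]
    rw [hz]
    exact hD.mem d hdD
  have hcl : ∀ q ∈ closure T, ∀ I : Set ℝ, IsOpen I → q 0 ∈ I → ∃ q' ∈ T, q' 0 ∈ I := by
    intro q hq I hI hqI
    obtain ⟨q', h1, h2⟩ := mem_closure_iff.1 hq _ (hI.preimage (continuous_coord 0)) hqI
    exact ⟨q', h2, h1⟩
  have hmax : ∀ q ∈ closure T, q 0 = d 0 → q ∈ D := fun q hq h0 =>
    hD.maximal d hdD q h0 ((hT.convex.closure.segment_subset hdT hq).trans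
      (hT.closure_subset hP.isClosed))
  have hnotC : ∀ q ∈ closure T, q ∉ T → q 0 ∈ C := fun q hq hqT => by
    by_contra h; exact hqT (hT.mem_of_mem_closure q hq h)
  have hcross' : ∀ q ∈ closure T, q ∉ T → ∀ q' ∈ T, q 0 ∉ Set.uIcc (q' 0) m := by
    intro q hq hqT q' hq' hmem
    rw [← segment_eq_uIcc, ← hbm] at hmem
    obtain ⟨s, t, hs, ht, hst, hz⟩ := hmem
    refine hT.notMem _ (hT.convex hq' hbT hs ht hst) ?_
    simp only [PiLp.add_apply, PiLp.smul_apply]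
    rw [hz]
    exact hnotC q hq hqT
  have hdC : ∀ q ∈ closure T, q ∉ T → (q 0 < m ∧ d 0 < m) ∨ (m < q 0 ∧ m < d 0) → q 0 = d 0 := by
    intro q hq hqT h
    rcases lt_trichotomy (q 0) (d 0) with h1 | h1 | h1
    · rcases h with ⟨h2, h3⟩ | ⟨h2, h3⟩
      · obtain ⟨q', hq', h4⟩ := hcl q hq (Set.Iio (d 0)) isOpen_Iio h1
        exact absurd (Set.mem_uIcc.2 (Or.inl ⟨le_of_lt h4, h3.le⟩)) (hcross q' hq')
      · obtain ⟨q', hq', h4⟩ := hcl d hdT (Set.Ioi (q 0)) isOpen_Ioi h1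
        exact absurd (Set.mem_uIcc.2 (Or.inr ⟨h2.le, le_of_lt h4⟩)) (hcross' q hq hqT q' hq')
    · exact h1
    · rcases h with ⟨h2, h3⟩ | ⟨h2, h3⟩
      · obtain ⟨q', hq', h4⟩ := hcl d hdT (Set.Iio (q 0)) isOpen_Iio h1
        exact absurd (Set.mem_uIcc.2 (Or.inl ⟨le_of_lt h4, h2.le⟩)) (hcross' q hq hqT q' hq')
      · obtain ⟨q', hq', h4⟩ := hcl q hq (Set.Ioi (d 0)) isOpen_Ioi h1
        exact absurd (Set.mem_uIcc.2 (Or.inr ⟨h3.le, le_of_lt h4⟩)) (hcross q' hq')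
  have hnotT : ∀ q ∈ L ∪ R, q ∉ T := fun q hq => by rw [hun] at hq; exact hq.2
  rcases hside d ⟨hdT, hdnT⟩ with ⟨hdm, hdL⟩ | ⟨hdm, hdR⟩
  · refine ⟨L, R, hL, hR, hLR, hun, hD.convex.isPreconnected.subset_of_closed_partition hR hL
      hLR.symm (by rwa [Set.union_comm]) ⟨d, hdD, hdL⟩, ?_⟩
    rintro q ⟨hq, hqL⟩
    have hqT := hnotT q (Or.inl hqL)
    rcases hside q ⟨hq, hqT⟩ with h | h
    · exact hmax q hq (hdC q hq hqT (Or.inl ⟨h.1, hdm⟩))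
    · exact absurd h.2 (Set.disjoint_left.1 hLR hqL)
  · refine ⟨R, L, hR, hL, hLR.symm, by rw [Set.union_comm, hun],
      hD.convex.isPreconnected.subset_of_closed_partition hL hR hLR hDsub ⟨d, hdD, hdR⟩, ?_⟩
    rintro q ⟨hq, hqR⟩
    have hqT := hnotT q (Or.inr hqR)
    rcases hside q ⟨hq, hqT⟩ with h | h
    · exact absurd hqR (Set.disjoint_left.1 hLR h.2)
    · exact hmax q hq (hdC q hq hqT (Or.inr ⟨h.1, hdm⟩))

/-- A chain of pieces that ends at `y` and does not use the cell `T` stays on one side of `T`. -/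
theorem Reaches.mem_of_subset {T A B : Set Plane} {y : Plane} (hP : IsClosed P)
    (hT : IsCell P C T) (hA : IsClosed A) (hB : IsClosed B) (hAB : Disjoint A B)
    (hun : A ∪ B = P \ T) : ∀ {n : ℕ} {K : Set Plane}, Reaches P C y n K →
    (∀ m ≤ n, ¬ Reaches P C y m (closure T)) → K ⊆ B → y ∈ B
  | 0, _, h, _, hK => hK h.2
  | n + 1, _, ⟨K', hadj, hK'⟩, hmin, hK => by
    have hsub := hK'.isPiece.subset_diff hT hP
      (fun h => hmin n (Nat.le_succ n) (h ▸ hK'))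
    obtain ⟨q, hq, hq'⟩ := hadj.1
    exact hK'.mem_of_subset hP hT hA hB hAB hun (fun m hm => hmin m (by omega))
      (hK'.isPiece.convex.isPreconnected.subset_of_closed_partition hA hB hAB
        (hun ▸ hsub) ⟨q, hq', hK hq⟩)

/-- On a shortest chain of pieces towards `y`, the intersection of a piece with the next one
separates it from `y`. -/
theorem IsFilledRegion.exists_gate (hP : IsFilledRegion u v P) {y : Plane} {n : ℕ}
    {K K' : Set Plane} (hK : HasRank P C y (n + 1) K) (hK' : HasRank P C y n K')
    (hadj : PieceAdj P C K K') : ∃ F G : Set Plane, IsClosed F ∧ IsClosed G ∧ P ⊆ F ∪ G ∧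
      P ∩ (F ∩ G) ⊆ K ∩ K' ∧ K ⊆ F ∧ y ∉ F := by
  have hsplit : ∀ {T A B : Set Plane}, A ∪ B = P \ T → ∀ q ∈ P, q ∈ A ∨ q ∈ T ∨ q ∈ B := by
    intro T A B h q hq
    by_cases hqT : q ∈ T
    · exact Or.inr (Or.inl hqT)
    · have : q ∈ A ∪ B := h ▸ ⟨hq, hqT⟩
      exact this.elim Or.inl fun h => Or.inr (Or.inr h)
  rcases hadj.2 with ⟨hD, T, hT, rfl⟩ | ⟨hD, T, hT, rfl⟩
  · obtain ⟨A, B, hA, hB, hAB, hun, hDA, hTA⟩ := hP.exists_partition hD hT hadj.1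
    refine ⟨A, closure T ∪ B, hA, isClosed_closure.union hB, fun q hq => ?_, ?_, hDA, ?_⟩
    · rcases hsplit hun q hq with h | h | h
      · exact Or.inl h
      · exact Or.inr (Or.inl (subset_closure h))
      · exact Or.inr (Or.inr h)
    · rintro q ⟨-, hqA, hq | hq⟩
      · exact ⟨hTA ⟨hq, hqA⟩, hq⟩
      · exact absurd hq (Set.disjoint_left.1 hAB hqA)
    · intro hyA
      cases n with
      | zero => exact hK.2 0 one_pos ⟨Or.inl hD, hTA ⟨hK'.1.2, hyA⟩⟩
      | succ n =>
        obtain ⟨J, hadj', hJ⟩ := hK'.exists_adj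
        have hJD : IsDoor P C J := by
          rcases hadj'.2 with h | h
          · exact absurd rfl (h.1.ne_closure hT)
          · exact h.1
        have hJsub : J ⊆ B ∪ A := by
          rw [Set.union_comm, hun]
          exact hJ.1.isPiece.subset_diff hT hP.isClosed (hJD.ne_closure hT)
        obtain ⟨q, hqT, hqJ⟩ := hadj'.1
        have hqB : q ∈ B := by
          refine (hJsub hqJ).resolve_right fun hqA => ?_
          have := hD.eq_of_mem hJD (hTA ⟨hqT, hqA⟩) hqJ
          exact hK.2 n (by omega) (this ▸ hJ.1)
        have hJB : J ⊆ B := hJ.1.isPiece.convex.isPreconnected.subset_of_closed_partition hA hB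
          hAB (by rwa [Set.union_comm]) ⟨q, hqJ, hqB⟩
        exact Set.disjoint_left.1 hAB hyA (hJ.1.mem_of_subset hP.isClosed hT hA hB hAB hun
          (fun m hm => hK'.2 m (by omega)) hJB)
  · obtain ⟨A, B, hA, hB, hAB, hun, hDA, hTA⟩ :=
      hP.exists_partition hD hT (by rw [Set.inter_comm]; exact hadj.1)
    have hyA : y ∈ A := hK'.1.mem_of_subset hP.isClosed hT hB hA hAB.symm
      (by rw [Set.union_comm, hun]) (fun m hm => hK.2 m (by omega)) hDA
    refine ⟨closure T ∪ B, A, isClosed_closure.union hB, hA, fun q hq => ?_, ?_,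
      Set.subset_union_left, ?_⟩
    · rcases hsplit hun q hq with h | h | h
      · exact Or.inr h
      · exact Or.inl (Or.inl (subset_closure h))
      · exact Or.inl (Or.inr h)
    · rintro q ⟨-, hq | hq, hqA⟩
      · exact ⟨hq, hTA ⟨hq, hqA⟩⟩
      · exact absurd hq (Set.disjoint_left.1 hAB hqA)
    · rintro (hy | hy)
      · exact hK.2 0 (by omega) ⟨Or.inr ⟨T, hT, rfl⟩, hy⟩
      · exact Set.disjoint_left.1 hAB hyA hy

end Piece

/-! ### Local convexity of the inner distance -/

section Local

variable {ι : Type*} {u v : ι → Plane} {P : Set Plane} {C : Set ℝ}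

/-- A filled region is locally star-shaped. -/
theorem IsFilledRegion.eventually_segment_subset [Finite ι] (hP : IsFilledRegion u v P)
    (p : Plane) : ∀ᶠ q in nhdsWithin p P, segment ℝ p q ⊆ P := by
  have hcl : ∀ i, IsClosed (segment ℝ (u i) (v i)) := fun i => by
    rw [segment_eq_image_lineMap]
    exact (isCompact_Icc.image (AffineMap.continuous_of_finiteDimensional _)).isClosed
  have hev : ∀ᶠ q in nhds p, ∀ i, p ∉ segment ℝ (u i) (v i) → q ∉ segment ℝ (u i) (v i) := by
    rw [Filter.eventually_all]
    intro i
    by_cases hi : p ∈ segment ℝ (u i) (v i)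
    · exact Filter.Eventually.of_forall fun q h => absurd hi h
    · filter_upwards [(hcl i).isOpen_compl.mem_nhds hi] with q hq _ using hq
  obtain ⟨r, hr, hball⟩ := Metric.eventually_nhds_iff_ball.1 hev
  filter_upwards [nhdsWithin_le_nhds (Metric.ball_mem_nhds p hr), self_mem_nhdsWithin]
    with q hq hqP
  have hseg : segment ℝ p q ⊆ Metric.ball p r :=
    (convex_ball p r).segment_subset (Metric.mem_ball_self hr) hq
  -- Cut the segment at its last point `w` on one of the edges; that edge passes through `p`.
  set g : ℝ → Plane := fun t => AffineMap.lineMap p q t with hg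
  have hgc : Continuous g := AffineMap.continuous_of_finiteDimensional _
  have hgseg : segment ℝ p q = g '' Set.Icc 0 1 := segment_eq_image_lineMap ℝ p q
  set S : Set ℝ := Set.Icc 0 1 ∩ g ⁻¹' ⋃ i, segment ℝ (u i) (v i) with hS
  have hScomp : IsCompact S :=
    isCompact_Icc.inter_right ((isClosed_iUnion_of_finite hcl).preimage hgc)
  have htail : ∀ s ∈ Set.Icc (0 : ℝ) 1, (∀ t ∈ S, t < s) → g s ∈ P := by
    intro s hs h
    have hpre : IsPreconnected (g '' Set.Icc s 1) := isPreconnected_Icc.image g hgc.continuousOn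
    refine hP.subset_of_isPreconnected _ hpre (fun i => Set.disjoint_left.2 ?_)
      ⟨q, ⟨1, ⟨hs.2, le_rfl⟩, by simp [hg]⟩, hqP⟩ ⟨s, ⟨le_rfl, hs.2⟩, rfl⟩
    rintro _ ⟨t, ht, rfl⟩ hti
    have := h t ⟨⟨hs.1.trans ht.1, ht.2⟩, Set.mem_iUnion.2 ⟨i, hti⟩⟩
    linarith [ht.1]
  rw [hgseg]
  rintro _ ⟨s, hs, rfl⟩
  rcases S.eq_empty_or_nonempty with hempty | hne
  · exact htail s hs (by simp [hempty])
  obtain ⟨t, ⟨htI, ht⟩, hmax⟩ := hScomp.exists_isGreatest hne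
  rcases lt_or_ge t s with hts | hts
  · exact htail s hs fun t' ht' => (hmax ht').trans_lt hts
  obtain ⟨i, hi⟩ := Set.mem_iUnion.1 ht
  have hpi : p ∈ segment ℝ (u i) (v i) := by
    by_contra hcon
    exact hball _ (hseg (hgseg ▸ ⟨t, htI, rfl⟩)) i hcon hi
  refine hP.segment_subset i ((convex_segment _ _).segment_subset hpi hi ?_)
  rcases htI.1.eq_or_lt with h0 | h0
  · have : s = 0 := le_antisymm (hts.trans h0.ge) hs.1
    rw [this]
    simp [hg, left_mem_segment]
  · rw [segment_eq_image_lineMap]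
    refine ⟨s / t, ⟨by have := hs.1; positivity, (div_le_one h0).2 hts⟩, ?_⟩
    simp only [hg, AffineMap.lineMap_apply_module']
    rw [add_sub_cancel_right, smul_smul, div_mul_cancel₀ _ h0.ne']

/-- Nearby points of the region share a piece. -/
theorem IsFilledRegion.eventually_exists_isPiece [Finite ι] (hP : IsFilledRegion u v P)
    {p : Plane} (hp : p ∈ P) : ∀ᶠ q in nhdsWithin p P,
      ∃ K, IsPiece P (criticalSet u v) K ∧ p ∈ K ∧ q ∈ K := by
  by_cases hC : p 0 ∈ criticalSet u v
  · have hcl : IsClosed (criticalSet u v \ {p 0}) :=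
      ((finite_criticalSet u v).subset Set.sdiff_subset).isClosed
    obtain ⟨r, hr, hball⟩ := exists_ball_slab hcl (x := p 0) (by simp)
    have hnear : ∀ᶠ q in nhds p, dist (q 0) (p 0) < r :=
      (continuous_coord 0).continuousAt.eventually (Metric.ball_mem_nhds (p 0) hr)
    filter_upwards [hP.eventually_segment_subset p, nhdsWithin_le_nhds hnear,
      self_mem_nhdsWithin] with q hseg hq hqP
    by_cases h0 : q 0 = p 0
    · obtain ⟨D, hD, hpD⟩ := exists_isDoor hp hC
      exact ⟨D, Or.inl hD, hpD, hD.maximal p hpD q h0 hseg⟩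
    have hcrit : ∀ x ∈ Set.uIcc (p 0) (q 0), x ≠ p 0 → x ∉ criticalSet u v :=
      fun x hx hne hxC => hball _ hq hx ⟨hxC, hne⟩
    obtain ⟨T, hT, hqT⟩ := hP.exists_isCell hqP (hcrit _ Set.right_mem_uIcc h0)
    refine ⟨closure T, Or.inr ⟨T, hT, rfl⟩, ?_, subset_closure hqT⟩
    -- The segment from `p` to `q` without `p` runs inside the cell of `q`.
    set g : ℝ → Plane := fun t => AffineMap.lineMap p q t with hg
    have hgc : Continuous g := AffineMap.continuous_of_finiteDimensional _
    have hgseg : segment ℝ p q = g '' Set.Icc 0 1 := segment_eq_image_lineMap ℝ p q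
    have hsub : g '' Set.Ioc 0 1 ⊆ T := by
      refine hT.subset_of_isPreconnected (isPreconnected_Ioc.image g hgc.continuousOn) ?_ ?_
        ⟨q, ⟨1, ⟨one_pos, le_rfl⟩, by simp [hg]⟩, hqT⟩
      · exact (Set.image_mono Set.Ioc_subset_Icc_self).trans (hgseg ▸ hseg)
      · rintro _ ⟨t, ht, rfl⟩
        have h1 : g t 0 = p 0 + t * (q 0 - p 0) := by
          simp [hg, AffineMap.lineMap_apply_module']
          ring
        refine hcrit _ ?_ ?_
        · rw [← segment_eq_uIcc]
          refine ⟨1 - t, t, by linarith [ht.2], ht.1.le, by ring, ?_⟩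
          rw [h1, smul_eq_mul, smul_eq_mul]; ring
        · rw [h1]
          intro h
          have : t * (q 0 - p 0) = 0 := by linarith
          exact (mul_ne_zero ht.1.ne' (sub_ne_zero.2 h0)) this
    have hmem : (0 : ℝ) ∈ closure (Set.Ioc (0 : ℝ) 1) := by
      rw [closure_Ioc (by norm_num)]
      exact ⟨le_rfl, zero_le_one⟩
    have := image_closure_subset_closure_image hgc ⟨0, hmem, rfl⟩
    have hg0 : g 0 = p := by simp [hg]
    rw [hg0] at this
    exact closure_mono hsub this
  · obtain ⟨T, hT, hpT⟩ := hP.exists_isCell hp hC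
    obtain ⟨O, hO, hOT⟩ := hT.isOpen
    have hpO : p ∈ O := (hOT.symm ▸ hpT : p ∈ O ∩ P).1
    filter_upwards [nhdsWithin_le_nhds (hO.mem_nhds hpO), self_mem_nhdsWithin] with q hq hqP
    exact ⟨closure T, Or.inr ⟨T, hT, rfl⟩, subset_closure hpT, subset_closure (hOT ▸ ⟨hq, hqP⟩)⟩

theorem Reaches.exists_of_mem {y q : Plane} {n : ℕ} {K J : Set Plane}
    (hPc : IsClosed P) (h : Reaches P C y n K) (hqK : q ∈ K) (hJ : IsPiece P C J) (hqJ : q ∈ J) :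
    ∃ n, Reaches P C y n J := by
  rcases h.isPiece with hK | ⟨T, hT, rfl⟩
  · rcases hJ with hJ | ⟨T', hT', rfl⟩
    · exact ⟨n, hK.eq_of_mem hJ hqK hqJ ▸ h⟩
    · exact ⟨n + 1, K, ⟨⟨q, hqJ, hqK⟩, Or.inr ⟨hK, T', hT', rfl⟩⟩, h⟩
  · rcases hJ with hJ | ⟨T', hT', rfl⟩
    · exact ⟨n + 1, _, ⟨⟨q, hqJ, hqK⟩, Or.inl ⟨hJ, T, hT, rfl⟩⟩, h⟩
    · by_cases hq : q 0 ∈ C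
      · obtain ⟨D, hD, hqD⟩ := exists_isDoor (hT.closure_subset hPc hqK) hq
        exact ⟨n + 2, D, ⟨⟨q, hqJ, hqD⟩, Or.inr ⟨hD, T', hT', rfl⟩⟩, _,
          ⟨⟨q, hqD, hqK⟩, Or.inl ⟨hD, T, hT, rfl⟩⟩, h⟩
      · have := hT.eq_of_mem hT' (hT.mem_of_mem_closure q hqK hq)
          (hT'.mem_of_mem_closure q hqJ hq)
        exact ⟨n, this ▸ h⟩

/-- The pieces met by a path to `y` can be joined to a piece containing `y`. -/
theorem IsFilledRegion.exists_reaches [Finite ι] (hP : IsFilledRegion u v P) {x y : Plane}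
    (γ : Path x y) (hγ : ∀ t, γ t ∈ P) :
    ∃ n K, x ∈ K ∧ Reaches P (criticalSet u v) y n K := by
  have hrange : IsPreconnected (Set.range γ) := isPreconnected_range γ.continuous
  have hsub : Set.range γ ⊆ P := by
    rintro _ ⟨t, rfl⟩; exact hγ t
  have hx : x ∈ Set.range γ := ⟨0, γ.source⟩
  have hy : y ∈ Set.range γ := ⟨1, γ.target⟩
  have hgood : ∃ n K, y ∈ K ∧ Reaches P (criticalSet u v) y n K := by
    obtain ⟨K, hK, hyK, -⟩ :=
      (hP.eventually_exists_isPiece (hsub hy)).self_of_nhdsWithin (hsub hy)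
    exact ⟨0, K, hyK, hK, hyK⟩
  refine (hrange.induction₂ (fun a b =>
    (∃ n K, a ∈ K ∧ Reaches P (criticalSet u v) y n K) ↔
      ∃ n K, b ∈ K ∧ Reaches P (criticalSet u v) y n K) ?_ ?_ ?_ hx hy).2 hgood
  · intro a ha
    filter_upwards [(hP.eventually_exists_isPiece (hsub ha)).filter_mono
      (nhdsWithin_mono a hsub)] with b hb
    obtain ⟨J, hJ, haJ, hbJ⟩ := hb
    constructor
    · rintro ⟨n, K, haK, hK⟩
      obtain ⟨n', hn'⟩ := hK.exists_of_mem hP.isClosed haK hJ haJ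
      exact ⟨n', J, hbJ, hn'⟩
    · rintro ⟨n, K, hbK, hK⟩
      obtain ⟨n', hn'⟩ := hK.exists_of_mem hP.isClosed hbK hJ hbJ
      exact ⟨n', J, haJ, hn'⟩
  · intro a b c _ _ _ hab hbc
    exact hab.trans hbc
  · intro a b _ _ hab
    exact hab.symm

/-- A shortest chain of pieces towards `y` yields a list of gates, namely the intersections of
consecutive pieces. -/
theorem HasRank.exists_gates (hP : IsFilledRegion u v P) {y : Plane} :
    ∀ {n : ℕ} {K : Set Plane}, HasRank P C y n K → ∃ Es : List (Set Plane),
      (∀ E ∈ Es, Convex ℝ E) ∧ (∃ Y ∈ nhdsWithin y P, Gated P Y K Es) ∧ Visible P y K Es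
  | 0, K, h => by
    refine ⟨[], by simp, ⟨P, self_mem_nhdsWithin, trivial⟩, fun x hx => ?_⟩
    exact (h.1.1.convex.segment_subset hx h.1.2).trans (h.1.1.subset hP.isClosed)
  | n + 1, K, h => by
    obtain ⟨K', hadj, hK'⟩ := h.exists_adj
    obtain ⟨Es, hconv, ⟨Y, hY, hgated⟩, hvis⟩ := hK'.exists_gates hP
    obtain ⟨F, G, hF, hG, hc, hi, hKF, hyF⟩ := hP.exists_gate h hK' hadj
    have hKc := hadj.isPiece.convex
    refine ⟨(K ∩ K') :: Es, ?_, ⟨Y ∩ (Fᶜ ∩ P), ?_, ?_, ?_⟩, ?_, ?_⟩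
    · rintro E hE
      rcases List.mem_cons.1 hE with rfl | hE
      · exact hKc.inter hK'.1.isPiece.convex
      · exact hconv E hE
    · exact Filter.inter_mem hY (Filter.inter_mem
        (nhdsWithin_le_nhds (hF.isOpen_compl.mem_nhds hyF)) self_mem_nhdsWithin)
    · exact ⟨F, G, hF, hG, hc, hi, hKF, fun q hq => (hc hq.2.2).resolve_left hq.2.1⟩
    · exact (hgated.anti Set.inter_subset_right).anti_right Set.inter_subset_left
    · exact fun x hx q hq => (hKc.segment_subset hx hq.1).trans
        (hadj.isPiece.subset hP.isClosed)
    · exact hvis.anti Set.inter_subset_right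

/-- The gates for a pair `x`, `y`, taken along a chain of pieces from `x` to `y` that is shortest
among all chains with these end points, are also gates for all nearby pairs. -/
theorem IsFilledRegion.exists_gates [Finite ι] (hP : IsFilledRegion u v P) {x y : Plane}
    (γ : Path x y) (hγ : ∀ t, γ t ∈ P) : ∃ Es : List (Set Plane), (∀ E ∈ Es, Convex ℝ E) ∧
      (∃ X ∈ nhdsWithin x P, ∃ Y ∈ nhdsWithin y P, Gated P Y X Es) ∧ Visible P y {x} Es := by
  classical
  have hex := hP.exists_reaches γ hγ
  obtain ⟨K, hxK, hK⟩ := Nat.find_spec hex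
  have hmin : ∀ m < Nat.find hex, ∀ K, x ∈ K → ¬ Reaches P (criticalSet u v) y m K :=
    fun m hm K hx hr => Nat.find_min hex hm ⟨K, hx, hr⟩
  have hrank : HasRank P (criticalSet u v) y (Nat.find hex) K :=
    ⟨hK, fun m hm => hmin m hm K hxK⟩
  generalize Nat.find hex = n at hrank hmin
  cases n with
  | zero =>
    obtain ⟨hKp, hyK⟩ : IsPiece P (criticalSet u v) K ∧ y ∈ K := hrank.1
    refine ⟨[], by simp, ⟨P, self_mem_nhdsWithin, P, self_mem_nhdsWithin, trivial⟩, ?_⟩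
    rintro _ rfl
    exact (hKp.convex.segment_subset hxK hyK).trans (hKp.subset hP.isClosed)
  | succ n =>
    obtain ⟨K', hadj, hK'⟩ := hrank.exists_adj
    obtain ⟨Es, hconv, ⟨Y, hY, hgated⟩, hvis⟩ := hK'.exists_gates hP
    obtain ⟨F, G, hF, hG, hc, hi, hKF, hyF⟩ := hP.exists_gate hrank hK' hadj
    have hKc := hadj.isPiece.convex
    have hKP := hadj.isPiece.subset hP.isClosed
    have hxG : x ∉ G := fun hxG =>
      hmin n (Nat.lt_succ_self n) K' (hi ⟨hKP hxK, hKF hxK, hxG⟩).2 hK'.1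
    refine ⟨(K ∩ K') :: Es, ?_, ⟨Gᶜ ∩ P, ?_, Y ∩ (Fᶜ ∩ P), ?_, ?_, ?_⟩, ?_, ?_⟩
    · rintro E hE
      rcases List.mem_cons.1 hE with rfl | hE
      · exact hKc.inter hK'.1.isPiece.convex
      · exact hconv E hE
    · exact Filter.inter_mem (nhdsWithin_le_nhds (hG.isOpen_compl.mem_nhds hxG))
        self_mem_nhdsWithin
    · exact Filter.inter_mem hY (Filter.inter_mem
        (nhdsWithin_le_nhds (hF.isOpen_compl.mem_nhds hyF)) self_mem_nhdsWithin)
    · exact ⟨F, G, hF, hG, hc, hi, fun q hq => (hc hq.2).resolve_right hq.1,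
        fun q hq => (hc hq.2.2).resolve_left hq.2.1⟩
    · exact (hgated.anti Set.inter_subset_right).anti_right Set.inter_subset_left
    · rintro _ rfl q hq
      exact (hKc.segment_subset hxK hq.1).trans hKP
    · exact hvis.anti Set.inter_subset_right

/-- The inner distance is midpoint convex near every pair of points at finite distance: the
distance through the gates of the pair is a convex function that agrees with the inner distance at
the pair and bounds it from below nearby. -/
theorem IsFilledRegion.innerDist_midpoint_le [Finite ι] (hP : IsFilledRegion u v P)
    {x y : Plane} (hxy : innerDist P x y ≠ ⊤) : ∃ X ∈ nhdsWithin x P, ∃ Y ∈ nhdsWithin y P,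
      ∀ x₁ ∈ X, ∀ x₂ ∈ X, ∀ y₁ ∈ Y, ∀ y₂ ∈ Y, midpoint ℝ x₁ x₂ = x → midpoint ℝ y₁ y₂ = y →
        2 * innerDist P x y ≤ innerDist P x₁ y₁ + innerDist P x₂ y₂ := by
  obtain ⟨γ, hγ⟩ : ∃ γ : Path x y, ∀ t, γ t ∈ P := by
    by_contra! hcon
    refine hxy (top_le_iff.1 (le_iInf₂ fun γ hγ => ?_))
    obtain ⟨t, ht⟩ := hcon γ
    exact absurd (hγ t) ht
  obtain ⟨Es, hconv, ⟨X, hX, Y, hY, hgated⟩, hvis⟩ := hP.exists_gates γ hγ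
  refine ⟨X, hX, Y, hY, fun x₁ hx₁ x₂ hx₂ y₁ hy₁ y₂ hy₂ hx hy => ?_⟩
  calc 2 * innerDist P x y ≤ 2 * gateDist Es x y := by
        gcongr; exact hvis.innerDist_le rfl
    _ = 2 * gateDist Es (midpoint ℝ x₁ x₂) (midpoint ℝ y₁ y₂) := by rw [hx, hy]
    _ ≤ gateDist Es x₁ y₁ + gateDist Es x₂ y₂ := gateDist_midpoint_le hconv _ _ _ _
    _ ≤ _ := add_le_add (hgated.gateDist_le_innerDist hx₁ hy₁)
        (hgated.gateDist_le_innerDist hx₂ hy₂)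

end Local

/-! ### Quasiconvexity of the inner distance along segments -/

/-- A continuous function that is midpoint convex in a neighbourhood of each point, the size of
which may depend on the point, is bounded by its values at the ends of the interval: otherwise
midpoint convexity fails at the first maximum. -/
theorem le_max_of_eventually_midpoint_le {F : ℝ → ℝ} (hF : ContinuousOn F (Set.Icc 0 1))
    (h : ∀ t ∈ Set.Ioo (0 : ℝ) 1, ∀ᶠ δ in nhdsWithin 0 (Set.Ioi 0),
      2 * F t ≤ F (t - δ) + F (t + δ)) {t : ℝ} (ht : t ∈ Set.Icc (0 : ℝ) 1) :
    F t ≤ max (F 0) (F 1) := by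
  obtain ⟨c, hc, hmax⟩ := isCompact_Icc.exists_isMaxOn ⟨t, ht⟩ hF
  refine (hmax ht).trans ?_
  by_contra! hcon
  have hcl : IsClosed (Set.Icc (0 : ℝ) 1 ∩ F ⁻¹' {F c}) :=
    hF.preimage_isClosed_of_isClosed isClosed_Icc isClosed_singleton
  have hcomp : IsCompact (Set.Icc (0 : ℝ) 1 ∩ F ⁻¹' {F c}) :=
    isCompact_Icc.of_isClosed_subset hcl Set.inter_subset_left
  obtain ⟨s, ⟨hs, hsF⟩, hleast⟩ := hcomp.exists_isLeast ⟨c, hc, rfl⟩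
  have hsF : F s = F c := hsF
  have hs0 : 0 < s := hs.1.lt_of_ne fun h0 => by
    rw [← h0] at hsF
    exact absurd hcon (not_lt.2 (hsF ▸ le_max_left _ _))
  have hs1 : s < 1 := hs.2.lt_of_ne fun h1 => by
    rw [h1] at hsF
    exact absurd hcon (not_lt.2 (hsF ▸ le_max_right _ _))
  have hev : ∀ᶠ δ : ℝ in nhdsWithin 0 (Set.Ioi 0), δ < s ∧ δ < 1 - s :=
    ((eventually_lt_nhds hs0).and (eventually_lt_nhds (sub_pos.2 hs1))).filter_mono
      nhdsWithin_le_nhds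
  obtain ⟨δ, ⟨hmid, hδs, hδ1⟩, hδ⟩ := ((h s ⟨hs0, hs1⟩).and hev |>.and self_mem_nhdsWithin).exists
  have hδ : 0 < δ := hδ
  have hl : s - δ ∈ Set.Icc (0 : ℝ) 1 := ⟨by linarith, by linarith⟩
  have hr : s + δ ∈ Set.Icc (0 : ℝ) 1 := ⟨by linarith, by linarith⟩
  have h1 : F (s - δ) < F c := (hmax hl).lt_of_ne fun heq => by
    have := hleast ⟨hl, heq⟩
    linarith
  have h2 : F (s + δ) ≤ F c := hmax hr
  linarith

section Quasiconvex

variable {ι : Type*} {u v : ι → Plane} {P : Set Plane}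

theorem innerDist_lineMap_le {x₀ x₁ y₀ y₁ : Plane} (hx : segment ℝ x₀ x₁ ⊆ P)
    (hy : segment ℝ y₀ y₁ ⊆ P) {s t : ℝ} (hs : s ∈ Set.Icc (0 : ℝ) 1)
    (ht : t ∈ Set.Icc (0 : ℝ) 1) :
    innerDist P (AffineMap.lineMap x₀ x₁ s) (AffineMap.lineMap y₀ y₁ s) ≤
      innerDist P (AffineMap.lineMap x₀ x₁ t) (AffineMap.lineMap y₀ y₁ t) +
        ENNReal.ofReal ((dist x₀ x₁ + dist y₀ y₁) * dist s t) := by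
  have hmem : ∀ {a b : Plane} {r : ℝ}, r ∈ Set.Icc (0 : ℝ) 1 →
      AffineMap.lineMap a b r ∈ segment ℝ a b := fun {a b r} hr => by
    rw [segment_eq_image_lineMap]; exact ⟨r, hr, rfl⟩
  have hstep : ∀ {a b : Plane}, segment ℝ a b ⊆ P → ∀ {r r' : ℝ}, r ∈ Set.Icc (0 : ℝ) 1 →
      r' ∈ Set.Icc (0 : ℝ) 1 → innerDist P (AffineMap.lineMap a b r) (AffineMap.lineMap a b r') ≤
        ENNReal.ofReal (dist a b * dist r r') := fun {a b} hab {r r'} hr hr' => by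
    refine (innerDist_le_edist
      (((convex_segment a b).segment_subset (hmem hr) (hmem hr')).trans hab)).trans ?_
    rw [edist_dist, dist_lineMap_lineMap, mul_comm]
  calc _ ≤ innerDist P (AffineMap.lineMap x₀ x₁ s) (AffineMap.lineMap x₀ x₁ t) +
        (innerDist P (AffineMap.lineMap x₀ x₁ t) (AffineMap.lineMap y₀ y₁ t) +
          innerDist P (AffineMap.lineMap y₀ y₁ t) (AffineMap.lineMap y₀ y₁ s)) :=
        (innerDist_triangle _ _ _ _).trans (add_le_add le_rfl (innerDist_triangle _ _ _ _))
    _ ≤ ENNReal.ofReal (dist x₀ x₁ * dist s t) +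
        (innerDist P (AffineMap.lineMap x₀ x₁ t) (AffineMap.lineMap y₀ y₁ t) +
          ENNReal.ofReal (dist y₀ y₁ * dist t s)) :=
        add_le_add (hstep hx hs ht) (add_le_add le_rfl (hstep hy ht hs))
    _ = _ := by
        rw [add_mul, ENNReal.ofReal_add (by positivity) (by positivity), dist_comm t s]
        ring

/-- Along two segments in a filled region, run through at constant speed, the inner distance is
bounded by its values at the two ends. -/
theorem IsFilledRegion.innerDist_lineMap_le_max [Finite ι] (hP : IsFilledRegion u v P)
    {x₀ x₁ y₀ y₁ : Plane} (hx : segment ℝ x₀ x₁ ⊆ P) (hy : segment ℝ y₀ y₁ ⊆ P) {t : ℝ}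
    (ht : t ∈ Set.Icc (0 : ℝ) 1) :
    innerDist P (AffineMap.lineMap x₀ x₁ t) (AffineMap.lineMap y₀ y₁ t) ≤
      max (innerDist P x₀ y₀) (innerDist P x₁ y₁) := by
  set x : ℝ → Plane := fun t => AffineMap.lineMap x₀ x₁ t with hxdef
  set y : ℝ → Plane := fun t => AffineMap.lineMap y₀ y₁ t with hydef
  have hx0 : x 0 = x₀ := by simp [hxdef]
  have hx1 : x 1 = x₁ := by simp [hxdef]
  have hy0 : y 0 = y₀ := by simp [hydef]
  have hy1 : y 1 = y₁ := by simp [hydef]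
  have hxc : Continuous x := AffineMap.continuous_of_finiteDimensional _
  have hyc : Continuous y := AffineMap.continuous_of_finiteDimensional _
  have hxP : ∀ s ∈ Set.Icc (0 : ℝ) 1, x s ∈ P := fun s hs =>
    hx (by rw [segment_eq_image_lineMap]; exact ⟨s, hs, rfl⟩)
  have hyP : ∀ s ∈ Set.Icc (0 : ℝ) 1, y s ∈ P := fun s hs =>
    hy (by rw [segment_eq_image_lineMap]; exact ⟨s, hs, rfl⟩)
  by_cases htop : innerDist P x₀ y₀ = ⊤
  · rw [htop, max_eq_left le_top]; exact le_top
  have h0 : (0 : ℝ) ∈ Set.Icc (0 : ℝ) 1 := ⟨le_rfl, zero_le_one⟩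
  have h1 : (1 : ℝ) ∈ Set.Icc (0 : ℝ) 1 := ⟨zero_le_one, le_rfl⟩
  have hfin : ∀ s ∈ Set.Icc (0 : ℝ) 1, innerDist P (x s) (y s) ≠ ⊤ := fun s hs => by
    refine ne_top_of_le_ne_top ?_ (innerDist_lineMap_le hx hy hs h0)
    exact ENNReal.add_ne_top.2 ⟨by simpa using htop, ENNReal.ofReal_ne_top⟩
  set F : ℝ → ℝ := fun s => (innerDist P (x s) (y s)).toReal with hF
  have hcont : ContinuousOn F (Set.Icc 0 1) := by
    have hK : 0 ≤ dist x₀ x₁ + dist y₀ y₁ := by positivity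
    refine LipschitzOnWith.continuousOn (K := ⟨_, hK⟩) (LipschitzOnWith.of_le_add_mul _ ?_)
    intro s hs t ht
    have h2 := ENNReal.toReal_mono
      (ENNReal.add_ne_top.2 ⟨hfin t ht, ENNReal.ofReal_ne_top⟩) (innerDist_lineMap_le hx hy hs ht)
    rwa [ENNReal.toReal_add (hfin t ht) ENNReal.ofReal_ne_top,
      ENNReal.toReal_ofReal (mul_nonneg hK dist_nonneg)] at h2
  have hmid : ∀ s ∈ Set.Ioo (0 : ℝ) 1, ∀ᶠ δ in nhdsWithin 0 (Set.Ioi 0),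
      2 * F s ≤ F (s - δ) + F (s + δ) := by
    intro s hs
    obtain ⟨X, hX, Y, hY, hloc⟩ := hP.innerDist_midpoint_le (hfin s ⟨hs.1.le, hs.2.le⟩)
    have hIcc : Set.Icc (0 : ℝ) 1 ∈ nhds s := Icc_mem_nhds hs.1 hs.2
    have hmem : ∀ {f : ℝ → Plane}, Continuous f → (∀ s ∈ Set.Icc (0 : ℝ) 1, f s ∈ P) →
        ∀ {Z : Set Plane}, Z ∈ nhdsWithin (f s) P → ∀ᶠ r in nhds s, f r ∈ Z := by
      intro f hf hfP Z hZ
      have : Filter.Tendsto f (nhds s) (nhdsWithin (f s) P) := by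
        refine tendsto_nhdsWithin_iff.2 ⟨hf.continuousAt, ?_⟩
        filter_upwards [hIcc] with r hr using hfP r hr
      exact this hZ
    have hall : ∀ᶠ r in nhds s, r ∈ Set.Icc (0 : ℝ) 1 ∧ x r ∈ X ∧ y r ∈ Y :=
      Filter.Eventually.and hIcc ((hmem hxc hxP hX).and (hmem hyc hyP hY))
    have hminus : Filter.Tendsto (fun δ : ℝ => s - δ) (nhds 0) (nhds s) := by
      have : Continuous fun δ : ℝ => s - δ := by fun_prop
      simpa using this.tendsto 0
    have hplus : Filter.Tendsto (fun δ : ℝ => s + δ) (nhds 0) (nhds s) := by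
      have : Continuous fun δ : ℝ => s + δ := by fun_prop
      simpa using this.tendsto 0
    refine Filter.Eventually.filter_mono nhdsWithin_le_nhds ?_
    filter_upwards [hminus.eventually hall, hplus.eventually hall] with δ hl hr
    have hmidpt : ∀ a b : Plane, midpoint ℝ (AffineMap.lineMap a b (s - δ))
        (AffineMap.lineMap a b (s + δ)) = (AffineMap.lineMap a b s : Plane) := by
      intro a b
      rw [midpoint_eq_smul_add, invOf_eq_inv]
      simp only [AffineMap.lineMap_apply_module']
      module
    have h2 := hloc _ hl.2.1 _ hr.2.1 _ hl.2.2 _ hr.2.2 (hmidpt _ _) (hmidpt _ _)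
    have hlf := hfin _ hl.1
    have hrf := hfin _ hr.1
    have h3 := ENNReal.toReal_mono (ENNReal.add_ne_top.2 ⟨hlf, hrf⟩) h2
    rwa [ENNReal.toReal_add hlf hrf, ENNReal.toReal_mul, ENNReal.toReal_ofNat] at h3
  have hle := le_max_of_eventually_midpoint_le hcont hmid ht
  have hft := hfin t ht
  have hf0 := hfin 0 h0
  have hf1 := hfin 1 h1
  have hmax : innerDist P (x t) (y t) ≤
      max (innerDist P (x 0) (y 0)) (innerDist P (x 1) (y 1)) := by
    rcases le_max_iff.1 hle with h | h
    · exact le_max_of_le_left ((ENNReal.toReal_le_toReal hft hf0).1 h)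
    · exact le_max_of_le_right ((ENNReal.toReal_le_toReal hft hf1).1 h)
  rwa [hx0, hx1, hy0, hy1] at hmax

end Quasiconvex

/-! ### Convexity of the free space in a cell -/

theorem PolygonalCurve.segmentInterval_subset {m : ℕ} (A : PolygonalCurve m) (i : Fin m) :
    A.segmentInterval i ⊆ Set.Icc 0 1 := by
  refine Set.Icc_subset_Icc ?_ ?_
  · rw [← A.breakpoint_zero]; exact A.strictMono.monotone (Fin.zero_le _)
  · rw [← A.breakpoint_last]; exact A.strictMono.monotone (Fin.le_last _)

theorem PolygonalCurve.toFun_lineMap {m : ℕ} (A : PolygonalCurve m) (i : Fin m) {s t r : ℝ}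
    (hs : s ∈ A.segmentInterval i) (ht : t ∈ A.segmentInterval i) (hr : r ∈ Set.Icc (0 : ℝ) 1) :
    A.toFun (AffineMap.lineMap s t r) = AffineMap.lineMap (A.toFun s) (A.toFun t) r := by
  have hmem : AffineMap.lineMap s t r ∈ A.segmentInterval i :=
    (convex_Icc _ _).lineMap_mem hs ht hr
  rw [A.affine i s hs, A.affine i t ht, A.affine i _ hmem]
  simp only [AffineMap.lineMap_apply_module', smul_eq_mul]
  module

theorem PolygonalCurve.segment_subset {m k : ℕ} {A : PolygonalCurve m} {P : Polygon Plane k}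
    (hA : A.LiesIn P) (i : Fin m) {s t : ℝ} (hs : s ∈ A.segmentInterval i)
    (ht : t ∈ A.segmentInterval i) : segment ℝ (A.toFun s) (A.toFun t) ⊆ polygonRegion P := by
  rw [segment_eq_image_lineMap]
  rintro _ ⟨r, hr, rfl⟩
  rw [← A.toFun_lineMap i hs ht hr]
  exact hA _ (A.segmentInterval_subset i ((convex_Icc _ _).lineMap_mem hs ht hr))

theorem convex_freeSpace_inter_freeSpaceCell {k m n : ℕ} (P : Polygon Plane k)
    {A : PolygonalCurve m} {B : PolygonalCurve n} (hA : A.LiesIn P) (hB : B.LiesIn P)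
    (i : Fin m) (j : Fin n) (ε : ℝ) :
    Convex ℝ (freeSpace P A B ε ∩ freeSpaceCell A B i j) := by
  rw [convex_iff_segment_subset]
  rintro p ⟨⟨-, -, hp⟩, hpA, hpB⟩ q ⟨⟨-, -, hq⟩, hqA, hqB⟩
  rw [segment_eq_image_lineMap]
  rintro _ ⟨r, hr, rfl⟩
  have h1 : (AffineMap.lineMap p q r : ℝ × ℝ).1 = AffineMap.lineMap p.1 q.1 r := by
    simp [AffineMap.lineMap_apply_module']
  have h2 : (AffineMap.lineMap p q r : ℝ × ℝ).2 = AffineMap.lineMap p.2 q.2 r := by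
    simp [AffineMap.lineMap_apply_module']
  have hrA : AffineMap.lineMap p.1 q.1 r ∈ A.segmentInterval i :=
    (convex_Icc _ _).lineMap_mem hpA hqA hr
  have hrB : AffineMap.lineMap p.2 q.2 r ∈ B.segmentInterval j :=
    (convex_Icc _ _).lineMap_mem hpB hqB hr
  refine ⟨⟨?_, ?_, ?_⟩, ?_, ?_⟩
  · rw [h1]; exact A.segmentInterval_subset i hrA
  · rw [h2]; exact B.segmentInterval_subset j hrB
  · rw [h1, h2, A.toFun_lineMap i hpA hqA hr, B.toFun_lineMap j hpB hqB hr]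
    -- By definition the geodesic distance is the inner distance of the polygonal region.
    have hle := (isFilledRegion_polygonRegion P).innerDist_lineMap_le_max
      (PolygonalCurve.segment_subset hA i hpA hqA) (PolygonalCurve.segment_subset hB j hpB hqB) hr
    rcases le_max_iff.1 hle with h | h
    · exact (EReal.coe_ennreal_le_coe_ennreal_iff.2 h).trans hp
    · exact (EReal.coe_ennreal_le_coe_ennreal_iff.2 h).trans hq
  · rw [h1]; exact hrA
  · rw [h2]; exact hrB

theorem mainTheorem4 {k m n : ℕ} (P : Polygon Plane k) (hP : IsSimplePolygon P)
    (A : PolygonalCurve m) (B : PolygonalCurve n) (hA : A.LiesIn P) (hB : B.LiesIn P)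
    (i : Fin m) (j : Fin n) (ε : ℝ) :
    (regions (freeSpace P A B ε ∩ freeSpaceCell A B i j)).Subsingleton ∧
      ∀ R ∈ regions (freeSpace P A B ε ∩ freeSpaceCell A B i j),
        R = freeSpace P A B ε ∩ freeSpaceCell A B i j ∧
          IsXMonotone R ∧ IsYMonotone R ∧ IsConnected R := by
  have hconv := convex_freeSpace_inter_freeSpaceCell P hA hB i j ε
  have hR : ∀ R ∈ regions (freeSpace P A B ε ∩ freeSpaceCell A B i j),
      R = freeSpace P A B ε ∩ freeSpaceCell A B i j := by
    rintro R ⟨p, hp, rfl⟩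
    exact hconv.isPreconnected.connectedComponentIn hp
  refine ⟨fun R h R' h' => (hR R h).trans (hR R' h').symm, fun R h => ⟨hR R h, ?_, ?_, ?_⟩⟩
  · rw [hR R h]
    intro x
    have hline : Convex ℝ {p : ℝ × ℝ | p.1 = x} :=
      (convex_singleton x).linear_preimage (LinearMap.fst ℝ ℝ ℝ)
    exact (hconv.inter hline).isPreconnected
  · rw [hR R h]
    intro y
    have hline : Convex ℝ {p : ℝ × ℝ | p.2 = y} :=
      (convex_singleton y).linear_preimage (LinearMap.snd ℝ ℝ ℝ)
    exact (hconv.inter hline).isPreconnected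
  · obtain ⟨p, hp, hpR⟩ := h
    rw [hpR, hconv.isPreconnected.connectedComponentIn hp]
    exact ⟨⟨p, hp⟩, hconv.isPreconnected⟩
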